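/- For a nonempty finite set $Q\subset\mathbb{R}$ let $\mu(Q)=\frac{1}{|Q|}\sum_{x\in Q}x$ and $\Delta(Q)=\sum_{x\in Q}(x-\mu(Q))^2$, and for finite sets $A,B\subset\mathbb{R}$ let $D(A,B)=\Delta(A\cup B)-\Delta(A)-\Delta(B)$. For a finite set $P\subset\mathbb{R}$ and an integer $k\ge 1$ let $$\mathrm{opt}_k(P)=\min_{C\subset\mathbb{R},\ |C|=k}\ \sum_{p\in P}\min_{c\in C}(p-c)^2$$ be the optimal value of the $k$-means objective. Ward's method on $P$, where $n=|P|$, starts with the clustering $\mathcal{W}_0=\{\{x\}\mid x\in P\}$ and performs $n-1$ merges: in step $i$ it chooses two distinct clusters $A,B\in\mathcal{W}_{i-1}$ for which $D(A,B)$ is minimal (ties are broken arbitrarily) and sets $\mathcal{W}_i=(\mathcal{W}_{i-1}\setminus\{A,B\})\cup\{A\cup B\}$. For $1\le k\le n$, the $k$-clustering that it computes is $\mathcal{W}_{n-k}$, and its cost is $\sum_{Q\in\mathcal{W}_{n-k}}\Delta(Q)$. Theorem. There is a universal constant $\alpha$ such that for every finite set $P\subset\mathbb{R}$, every integer $k$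 with $1\le k\le |P|$, and every possible run $\mathcal{W}_0,\ldots,\mathcal{W}_{|P|-1}$ of Ward's method on $P$, $$\sum_{Q\in\mathcal{W}_{|P|-k}}\Delta(Q)\ \le\ \alpha\cdot \mathrm{opt}_k(P).$$ That is, on one-dimensional instances the $k$-clustering computed by Ward's method is an $\mathcal{O}(1)$-approximation with respect to the $k$-means objective, for every $k$. -/

import Mathlib

noncomputable section

namespace Ward

/-- The centroid `μ(Q)` of a finite (nonempty) set of points on the line. -/
def centroid (Q : Finset ℝ) : ℝ := (∑ x ∈ Q, x) / (Q.card : ℝ)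

/-- `Δ(Q, c)`: the sum of the squared distances of the points of `Q` to the center `c`. -/
def costAt (Q : Finset ℝ) (c : ℝ) : ℝ := ∑ x ∈ Q, (x - c) ^ 2

/-- The 1-means cost `Δ(Q) = Δ(Q, μ(Q))`. -/
def cost (Q : Finset ℝ) : ℝ := costAt Q (centroid Q)

/-- `D(A, B) = Δ(A ∪ B) - Δ(A) - Δ(B)`: the cost of merging `A` and `B`. -/
def mergeCost (A B : Finset ℝ) : ℝ := cost (A ∪ B) - cost A - cost B

/-- The k-means objective `Δ(P, C) = ∑_{p ∈ P} min_{c ∈ C} |p - c|²` of a nonempty finite set `C`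
of centers. -/
def kMeansCost (P C : Finset ℝ) : ℝ := ∑ p ∈ P, ⨅ c : C, (p - (c : ℝ)) ^ 2

/-- `opt_k(P)` for `k ≥ 1`: the optimal value of the k-means objective over all sets of exactly
`k` centers on the line. -/
def opt (k : ℕ) (P : Finset ℝ) : ℝ := sInf {v : ℝ | ∃ C : Finset ℝ, C.card = k ∧ kMeansCost P C = v}

/-- The clustering that results from `𝒞` by merging its clusters `A` and `B`. -/
def merge (𝒞 : Finset (Finset ℝ)) (A B : Finset ℝ) : Finset (Finset ℝ) :=
  insert (A ∪ B) (𝒞 \ {A, B})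

/-- Two different clusters of `𝒞` form a greedy merge if no merge of two different clusters of
`𝒞` is cheaper. -/
def IsGreedyMerge (𝒞 : Finset (Finset ℝ)) (A B : Finset ℝ) : Prop :=
  A ∈ 𝒞 ∧ B ∈ 𝒞 ∧ A ≠ B ∧
    ∀ A' ∈ 𝒞, ∀ B' ∈ 𝒞, A' ≠ B' → mergeCost A B ≤ mergeCost A' B'

/-- `W 0, …, W (|P| - 1)` is a possible run of Ward's method on `P`: it starts with the singleton
clusters and performs `|P| - 1` greedy merges (ties broken in any way). Only the clusterings with
index less than `|P|` matter. -/
structure IsWardClustering (P : Finset ℝ) (W : ℕ → Finset (Finset ℝ)) : Prop where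
  init : W 0 = P.image fun x => {x}
  step : ∀ i : ℕ, i + 1 < P.card → ∃ A B : Finset ℝ,
    IsGreedyMerge (W i) A B ∧ W (i + 1) = merge (W i) A B

/-- The k-means cost `∑_Q Δ(Q)` of the `k`-clustering (the one after `|P| - k` merges) contained
in the hierarchical clustering `W` of `P`, for `1 ≤ k ≤ |P|`. -/
def hierarchicalCost (P : Finset ℝ) (W : ℕ → Finset (Finset ℝ)) (k : ℕ) : ℝ :=
  ∑ Q ∈ W (P.card - k), cost Q

end Ward

end

/-!
Fix a set of `k` centers and color each point with its nearest center, so that the color classes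
are intervals; the cost of the run is compared with the cost of this coloring. By the
Lance–Williams formula, a greedy merge never makes a later merge cheaper, so the costs of the
successive merges increase; and a cluster between two others would be cheaper to merge with one of
them, so the clusters remain intervals.

It therefore suffices to hold, at each time, at least as many coupons as there are merges left,
each worth at least the current merge cost, if their total worth at the start is a constant times
the cost of the coloring. There are two kinds of coupons.
* Merging two pure clusters of a color `i` costs at most the sum of their shift costs towards the
  center of `i`. A potential built from the shift costs supplies one coupon for each pure cluster
  of `i` in excess of the first.
* If two clusters have at least half of their points in the color `i` and the others in neighboring
  colors, then `i` is contested: merging the two bounds the current merge cost by the cost of the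
  clusters around `i`, and `i` supplies two coupons. That local cost stays bounded: a merge near `i`
  that the potential does not pay for multiplies it by at most five, and uses up the pure clusters
  of one of only three colors.

There are enough coupons: every cluster contains a whole color class or is centered at some color
in the sense above. A color that is not contested accounts for at most one cluster in this way, and
any color accounts for at most two clusters besides its pure ones. So the number of clusters exceeds
the number of colors by at most the number of coupons.
-/

namespace Ward

section Order

variable {α : Type*} [LinearOrder α]

/-- `A` lies entirely to the left of `B`. -/
def Precedes (A B : Finset α) : Prop := ∀ a ∈ A, ∀ b ∈ B, a < b

theorem Precedes.disjoint {A B : Finset α} (h : Precedes A B) : Disjoint A B :=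
  Finset.disjoint_left.2 fun x hA hB => lt_irrefl x (h x hA x hB)

theorem Precedes.union_left {A B C : Finset α} (hA : Precedes A C) (hB : Precedes B C) :
    Precedes (A ∪ B) C :=
  fun x hx => (Finset.mem_union.1 hx).elim (hA x) (hB x)

theorem Precedes.union_right {A B C : Finset α} (hB : Precedes A B) (hC : Precedes A C) :
    Precedes A (B ∪ C) :=
  fun x hx y hy => (Finset.mem_union.1 hy).elim (hB x hx y) (hC x hx y)

theorem Precedes.trans {A B C : Finset α} (hAB : Precedes A B) (hBC : Precedes B C)
    (hB : B.Nonempty) : Precedes A C := fun a ha c hc =>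
  let ⟨b, hb⟩ := hB
  (hAB a ha b hb).trans (hBC b hb c hc)

/-- `𝒞` is a partition of `P` into nonempty clusters of consecutive points, expressed by the
condition that any two clusters are separated. -/
structure IsIntervalPartition (P : Finset α) (𝒞 : Finset (Finset α)) : Prop where
  nonempty : ∀ Q ∈ 𝒞, Q.Nonempty
  biUnion_eq : 𝒞.biUnion id = P
  precedes : ∀ A ∈ 𝒞, ∀ B ∈ 𝒞, A ≠ B → Precedes A B ∨ Precedes B A

namespace IsIntervalPartition

variable {P : Finset α} {𝒞 : Finset (Finset α)} {A B : Finset α}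

theorem subset (h : IsIntervalPartition P 𝒞) (hA : A ∈ 𝒞) : A ⊆ P :=
  h.biUnion_eq ▸ Finset.subset_biUnion_of_mem id hA

theorem exists_mem (h : IsIntervalPartition P 𝒞) {x : α} (hx : x ∈ P) : ∃ Q ∈ 𝒞, x ∈ Q := by
  simpa only [← h.biUnion_eq, Finset.mem_biUnion, id] using hx

theorem disjoint (h : IsIntervalPartition P 𝒞) (hA : A ∈ 𝒞) (hB : B ∈ 𝒞) (hAB : A ≠ B) :
    Disjoint A B :=
  (h.precedes A hA B hB hAB).elim Precedes.disjoint fun hBA => hBA.disjoint.symm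

theorem eq_of_mem (h : IsIntervalPartition P 𝒞) (hA : A ∈ 𝒞) (hB : B ∈ 𝒞) {x : α}
    (hxA : x ∈ A) (hxB : x ∈ B) : A = B := by
  by_contra hAB
  exact Finset.disjoint_left.1 (h.disjoint hA hB hAB) hxA hxB

theorem union_notMem_sdiff (h : IsIntervalPartition P 𝒞) (hA : A ∈ 𝒞) (B : Finset α) :
    A ∪ B ∉ 𝒞 \ {A, B} := by
  intro hmem
  obtain ⟨hU, hne⟩ := Finset.mem_sdiff.1 hmem
  obtain ⟨x, hx⟩ := h.nonempty A hA
  exact hne (Finset.mem_insert.2 (.inl (h.eq_of_mem hU hA (Finset.mem_union_left B hx) hx)))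

theorem singletons (P : Finset α) : IsIntervalPartition P (P.image fun x => {x}) where
  nonempty := by simp
  biUnion_eq := by ext x; simp
  precedes := by
    simp only [Finset.forall_mem_image, ne_eq, Finset.singleton_inj]
    intro x _ y _ hxy
    simpa only [Precedes, Finset.mem_singleton, forall_eq] using lt_or_gt_of_ne hxy

end IsIntervalPartition

end Order

section Cost

variable {A B C : Finset ℝ}

theorem card_mul_centroid (Q : Finset ℝ) : Q.card * centroid Q = ∑ x ∈ Q, x := by
  rcases Q.eq_empty_or_nonempty with rfl | hQ
  · simp
  · exact mul_div_cancel₀ _ (Nat.cast_ne_zero.2 hQ.card_ne_zero)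

theorem sum_sub_centroid (Q : Finset ℝ) : ∑ x ∈ Q, (x - centroid Q) = 0 := by
  rw [Finset.sum_sub_distrib, Finset.sum_const, nsmul_eq_mul, card_mul_centroid, sub_self]

theorem costAt_nonneg (Q : Finset ℝ) (c : ℝ) : 0 ≤ costAt Q c :=
  Finset.sum_nonneg fun _ _ => sq_nonneg _

theorem cost_nonneg (Q : Finset ℝ) : 0 ≤ cost Q :=
  costAt_nonneg Q _

theorem cost_singleton (x : ℝ) : cost {x} = 0 := by
  simp [cost, costAt, centroid]

/-- The cost of moving all points of `Q` from their centroid to `c`; it is the excess of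
`Δ(Q, c)` over `Δ(Q)`. -/
noncomputable def shiftCost (c : ℝ) (Q : Finset ℝ) : ℝ := Q.card * (centroid Q - c) ^ 2

theorem shiftCost_nonneg (c : ℝ) (Q : Finset ℝ) : 0 ≤ shiftCost c Q :=
  mul_nonneg (Nat.cast_nonneg _) (sq_nonneg _)

theorem shiftCost_singleton (c x : ℝ) : shiftCost c {x} = (x - c) ^ 2 := by
  simp [shiftCost, centroid]

theorem shiftCost_centroid (Q : Finset ℝ) : shiftCost (centroid Q) Q = 0 := by
  simp [shiftCost]

theorem costAt_eq_cost_add_shiftCost (Q : Finset ℝ) (c : ℝ) :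
    costAt Q c = cost Q + shiftCost c Q := by
  calc costAt Q c
      = ∑ x ∈ Q, ((x - centroid Q) ^ 2 + 2 * (centroid Q - c) * (x - centroid Q) +
          (centroid Q - c) ^ 2) := Finset.sum_congr rfl fun x _ => by ring
    _ = cost Q + shiftCost c Q := by
        rw [Finset.sum_add_distrib, Finset.sum_add_distrib, ← Finset.mul_sum, sum_sub_centroid,
          mul_zero, add_zero, Finset.sum_const, nsmul_eq_mul, cost, costAt, shiftCost]

theorem costAt_union (h : Disjoint A B) (c : ℝ) : costAt (A ∪ B) c = costAt A c + costAt B c :=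
  Finset.sum_union h

theorem costAt_mono (h : A ⊆ B) (c : ℝ) : costAt A c ≤ costAt B c :=
  Finset.sum_le_sum_of_subset_of_nonneg h fun _ _ _ => sq_nonneg _

theorem mergeCost_comm (A B : Finset ℝ) : mergeCost A B = mergeCost B A := by
  rw [mergeCost, mergeCost, Finset.union_comm, sub_right_comm]

theorem shiftCost_union (h : Disjoint A B) (c : ℝ) :
    shiftCost c (A ∪ B) = shiftCost c A + shiftCost c B - mergeCost A B := by
  have hunion := costAt_union h c
  simp only [costAt_eq_cost_add_shiftCost] at hunion
  rw [mergeCost]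
  linarith

theorem mergeCost_le_shiftCost_add (h : Disjoint A B) (c : ℝ) :
    mergeCost A B ≤ shiftCost c A + shiftCost c B := by
  linarith [shiftCost_union h c, shiftCost_nonneg c (A ∪ B)]

theorem mergeCost_nonneg (h : Disjoint A B) : 0 ≤ mergeCost A B := by
  have hunion := shiftCost_union h (centroid (A ∪ B))
  rw [shiftCost_centroid] at hunion
  linarith [shiftCost_nonneg (centroid (A ∪ B)) A, shiftCost_nonneg (centroid (A ∪ B)) B]

theorem card_add_card_mul_centroid_union (h : Disjoint A B) :
    (A.card + B.card) * centroid (A ∪ B) = A.card * centroid A + B.card * centroid B := by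
  rw [card_mul_centroid, card_mul_centroid, ← Finset.sum_union h, ← card_mul_centroid (A ∪ B),
    Finset.card_union_of_disjoint h, Nat.cast_add]

theorem card_add_card_mul_mergeCost (h : Disjoint A B) :
    (A.card + B.card) * mergeCost A B = A.card * B.card * (centroid A - centroid B) ^ 2 := by
  have hunion := shiftCost_union h (centroid B)
  have hcentroid := card_add_card_mul_centroid_union h
  simp only [shiftCost, Finset.card_union_of_disjoint h, Nat.cast_add, sub_self] at hunion
  linear_combination (A.card + B.card : ℝ) * hunion -
    ((A.card + B.card) * (centroid (A ∪ B) - centroid B) +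
      A.card * (centroid A - centroid B)) * hcentroid

/-- The Lance–Williams update formula for Ward's method. -/
theorem card_mul_mergeCost_union (hAB : Disjoint A B) (hAC : Disjoint A C) (hBC : Disjoint B C) :
    (A.card + B.card + C.card) * mergeCost (A ∪ B) C =
      (A.card + C.card) * mergeCost A C + (B.card + C.card) * mergeCost B C
        - C.card * mergeCost A B := by
  have hunion := shiftCost_union hAB (centroid C)
  have hABC := card_add_card_mul_mergeCost (Finset.disjoint_union_left.2 ⟨hAC, hBC⟩)
  simp only [shiftCost, Finset.card_union_of_disjoint hAB, Nat.cast_add] at hunion hABC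
  linear_combination hABC - card_add_card_mul_mergeCost hAC - card_add_card_mul_mergeCost hBC +
    C.card * hunion

theorem mergeCost_le_mergeCost_union (hAB : Disjoint A B) (hAC : Disjoint A C)
    (hBC : Disjoint B C) (hA : A.Nonempty) (hleA : mergeCost A B ≤ mergeCost A C)
    (hleB : mergeCost A B ≤ mergeCost B C) : mergeCost A B ≤ mergeCost (A ∪ B) C := by
  have := Nat.cast_pos (α := ℝ).2 hA.card_pos
  refine le_of_mul_le_mul_left ?_ (by positivity : (0 : ℝ) < A.card + B.card + C.card)
  calc (A.card + B.card + C.card) * mergeCost A B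
      = (A.card + C.card) * mergeCost A B + (B.card + C.card) * mergeCost A B
          - C.card * mergeCost A B := by ring
    _ ≤ (A.card + C.card) * mergeCost A C + (B.card + C.card) * mergeCost B C
          - C.card * mergeCost A B := by gcongr
    _ = (A.card + B.card + C.card) * mergeCost (A ∪ B) C :=
        (card_mul_mergeCost_union hAB hAC hBC).symm

theorem exists_centroid_le (hA : A.Nonempty) : ∃ x ∈ A, centroid A ≤ x :=
  Finset.exists_le_of_sum_le hA (by rw [Finset.sum_const, nsmul_eq_mul, card_mul_centroid])

theorem exists_le_centroid (hA : A.Nonempty) : ∃ x ∈ A, x ≤ centroid A :=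
  Finset.exists_le_of_sum_le hA (by rw [Finset.sum_const, nsmul_eq_mul, card_mul_centroid])

theorem Precedes.centroid_lt (h : Precedes A B) (hA : A.Nonempty) (hB : B.Nonempty) :
    centroid A < centroid B := by
  obtain ⟨a, ha, hle⟩ := exists_centroid_le hA
  obtain ⟨b, hb, hge⟩ := exists_le_centroid hB
  exact hle.trans_lt ((h a ha b hb).trans_le hge)

theorem mergeCost_lt_shiftCost_centroid (h : Disjoint A B) (hA : A.Nonempty)
    (hne : centroid A ≠ centroid B) : mergeCost A B < shiftCost (centroid B) A := by
  have := Nat.cast_pos (α := ℝ).2 hA.card_pos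
  have := sub_ne_zero.2 hne
  refine lt_of_mul_lt_mul_left ?_ (by positivity : (0 : ℝ) ≤ A.card + B.card)
  have hpos : 0 < A.card * (A.card * (centroid A - centroid B) ^ 2) := by positivity
  rw [card_add_card_mul_mergeCost h, shiftCost]
  linarith

theorem mergeCost_lt_or_lt_of_between (hA : A.Nonempty) (hB : B.Nonempty) (hC : C.Nonempty)
    (hAC : Precedes A C) (hCB : Precedes C B) :
    mergeCost A C < mergeCost A B ∨ mergeCost C B < mergeCost A B := by
  by_contra! hle
  have := Nat.cast_pos (α := ℝ).2 hA.card_pos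
  have hltC := hAC.centroid_lt hA hC
  have hltB := hCB.centroid_lt hC hB
  have hltA : mergeCost A B < shiftCost (centroid C) A :=
    hle.1.trans_lt (mergeCost_lt_shiftCost_centroid hAC.disjoint hA hltC.ne)
  have hltB' : mergeCost A B < shiftCost (centroid C) B := by
    rw [mergeCost_comm C B] at hle
    exact hle.2.trans_lt (mergeCost_lt_shiftCost_centroid hCB.disjoint.symm hB hltB.ne')
  have hsplit : (A.card + B.card) * mergeCost A B =
      B.card * shiftCost (centroid C) A + A.card * shiftCost (centroid C) B +
        2 * (A.card * B.card * ((centroid C - centroid A) * (centroid B - centroid C))) := by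
    rw [card_add_card_mul_mergeCost (hAC.trans hCB hC).disjoint, shiftCost, shiftCost]
    ring
  have hprod : 0 ≤ (A.card * B.card * ((centroid C - centroid A) * (centroid B - centroid C))) :=
    mul_nonneg (by positivity) (mul_nonneg (sub_nonneg.2 hltC.le) (sub_nonneg.2 hltB.le))
  have hltA' : A.card * mergeCost A B < A.card * shiftCost (centroid C) B := by gcongr
  have hleB : B.card * mergeCost A B ≤ B.card * shiftCost (centroid C) A := by gcongr
  linarith

end Cost

section Amortization

/-- The values `a t` and sizes `n t` describe a reserve of coupons: the `J - t` prices still to be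
paid at time `t` need not exceed its size, its coupons are worth at least the current price on
average, and so are those used up at time `t`. -/
theorem sum_range_le_of_reserve {J : ℕ} {e n a : ℕ → ℝ} (hnonneg : 0 ≤ e 0)
    (hmono : ∀ t, t + 1 < J → e t ≤ e (t + 1)) (hsize : ∀ t < J, (J : ℝ) - t ≤ n t)
    (hvalue : ∀ t < J, n t * e t ≤ a t)
    (hstep : ∀ t, t + 1 < J → (n t - n (t + 1)) * e t ≤ a t - a (t + 1)) (hJ : 0 < J) :
    ∑ t ∈ Finset.range J, e t ≤ a 0 := by
  obtain ⟨J, rfl⟩ := Nat.exists_eq_succ_of_ne_zero hJ.ne'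
  suffices hstrong : ∑ t ∈ Finset.range (J + 1), e t ≤ a 0 - (n 0 - (J + 1)) * e 0 by
    have hspare : 0 ≤ (n 0 - (J + 1)) * e 0 :=
      mul_nonneg (sub_nonneg.2 (by simpa using hsize 0 hJ)) hnonneg
    linarith
  clear hJ hnonneg
  induction J generalizing e n a with
  | zero =>
    have := hvalue 0 Nat.one_pos
    simp only [zero_add, Finset.sum_range_one, Nat.cast_zero]
    linarith
  | succ J ih =>
    have htail := ih (e := fun t => e (t + 1)) (n := fun t => n (t + 1)) (a := fun t => a (t + 1))
      (fun t ht => hmono _ (by omega)) (fun t ht => by simpa using hsize (t + 1) (by omega))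
      (fun t ht => hvalue _ (by omega))
      (fun t ht => hstep _ (by omega))
    have hfirst : (n 0 - n 1) * e 0 ≤ a 0 - a 1 := hstep 0 (by omega)
    have hsize1 : (J + 1 : ℝ) ≤ n 1 := by simpa using hsize 1 (by omega)
    have hspare : (n 1 - (J + 1)) * e 0 ≤ (n 1 - (J + 1)) * e 1 :=
      mul_le_mul_of_nonneg_left (hmono 0 (by omega)) (sub_nonneg.2 hsize1)
    rw [Finset.sum_range_succ']
    push_cast
    simp only [zero_add] at htail
    linarith

variable {ι : Type*} {w : ι → ℝ} {s : Finset ι} {a : ι}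

theorem card_sub_card_mul_le_sum_sub {u : Finset ι} {e : ℝ} (hus : u ⊆ s)
    (h : ∀ a ∈ s, e ≤ w a) : ((s.card : ℝ) - u.card) * e ≤ ∑ a ∈ s, w a - ∑ a ∈ u, w a := by
  classical
  have hdiff := Finset.card_nsmul_le_sum (s \ u) w e fun a ha => h a (Finset.mem_sdiff.1 ha).1
  rwa [nsmul_eq_mul, Finset.cast_card_sdiff hus, Finset.sum_sdiff_eq_sub hus] at hdiff

/-- The total weight of `s` without its lightest element. -/
noncomputable def sumEraseMin (w : ι → ℝ) (s : Finset ι) : ℝ := ⨆ a : s, (∑ b ∈ s, w b - w a)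

theorem sum_sub_le_sumEraseMin (w : ι → ℝ) (ha : a ∈ s) : ∑ b ∈ s, w b - w a ≤ sumEraseMin w s :=
  le_ciSup (f := fun a : s => ∑ b ∈ s, w b - w a) (Set.finite_range _).bddAbove ⟨a, ha⟩

theorem sumEraseMin_le {r : ℝ} (hr : 0 ≤ r) (h : ∀ a ∈ s, ∑ b ∈ s, w b - w a ≤ r) :
    sumEraseMin w s ≤ r :=
  Real.iSup_le (fun a => h a a.2) hr

theorem exists_sumEraseMin_eq (w : ι → ℝ) (hs : s.Nonempty) :
    ∃ a ∈ s, sumEraseMin w s = ∑ b ∈ s, w b - w a := by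
  have := hs.to_subtype
  obtain ⟨⟨a, ha⟩, heq⟩ := exists_eq_ciSup_of_finite (f := fun a : s => ∑ b ∈ s, w b - w a)
  exact ⟨a, ha, heq.symm⟩

theorem sumEraseMin_nonneg (hw : ∀ a, 0 ≤ w a) (s : Finset ι) : 0 ≤ sumEraseMin w s :=
  Real.iSup_nonneg fun a => sub_nonneg.2 (Finset.single_le_sum (fun b _ => hw b) a.2)

theorem sumEraseMin_le_sum (hw : ∀ a, 0 ≤ w a) (s : Finset ι) : sumEraseMin w s ≤ ∑ a ∈ s, w a :=
  sumEraseMin_le (Finset.sum_nonneg fun b _ => hw b) fun a _ => sub_le_self _ (hw a)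

theorem card_sub_one_mul_le_sumEraseMin (hw : ∀ a, 0 ≤ w a) {e : ℝ}
    (h : ∀ a ∈ s, ∀ b ∈ s, a ≠ b → e ≤ w a + w b) :
    ((s.card - 1 : ℕ) : ℝ) * e ≤ 2 * sumEraseMin w s := by
  classical
  rcases s.eq_empty_or_nonempty with rfl | hs
  · simpa using sumEraseMin_nonneg hw ∅
  obtain ⟨a, ha, hmin⟩ := s.exists_min_image w hs
  have hhalf : (s.erase a).card • (e / 2) ≤ ∑ b ∈ s.erase a, w b := by
    refine Finset.card_nsmul_le_sum _ _ _ fun b hb => ?_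
    obtain ⟨hba, hb⟩ := Finset.mem_erase.1 hb
    linarith [h a ha b hb hba.symm, hmin b hb]
  rw [Finset.card_erase_of_mem ha, nsmul_eq_mul, Finset.sum_erase_eq_sub ha] at hhalf
  linarith [sum_sub_le_sumEraseMin w ha]

variable [DecidableEq ι]

theorem exists_add_le_sumEraseMin_sub_erase (w : ι → ℝ) (ha : a ∈ s) (hne : (s.erase a).Nonempty) :
    ∃ b ∈ s, b ≠ a ∧ w a + w b ≤ 2 * (sumEraseMin w s - sumEraseMin w (s.erase a)) := by
  obtain ⟨b, hb, heq⟩ := exists_sumEraseMin_eq w hne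
  obtain ⟨hba, hb⟩ := Finset.mem_erase.1 hb
  rw [Finset.sum_erase_eq_sub ha] at heq
  exact ⟨b, hb, hba, by linarith [sum_sub_le_sumEraseMin w ha, sum_sub_le_sumEraseMin w hb]⟩

theorem card_sub_card_erase_mul_le_sumEraseMin_sub (hw : ∀ a, 0 ≤ w a) {e : ℝ}
    (h : ∀ b ∈ s, b ≠ a → e ≤ w a + w b) :
    (((s.card - 1 : ℕ) : ℝ) - ((s.erase a).card - 1 : ℕ)) * e ≤
      2 * (sumEraseMin w s - sumEraseMin w (s.erase a)) := by
  by_cases ha : a ∈ s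
  swap
  · simp [Finset.erase_eq_of_notMem ha]
  rcases (s.erase a).eq_empty_or_nonempty with hempty | hne
  · have hcard := Finset.card_erase_add_one ha
    rw [hempty, Finset.card_empty] at hcard
    have hsE := sumEraseMin_nonneg hw s
    have hempty_le : sumEraseMin w ∅ ≤ 0 := sumEraseMin_le_sum hw ∅
    rw [hempty, ← hcard]
    simp only [Finset.card_empty, Nat.zero_sub, Nat.add_sub_cancel, sub_self, zero_mul]
    linarith
  · obtain ⟨b, hb, hba, hle⟩ := exists_add_le_sumEraseMin_sub_erase w ha hne
    have hcard := Finset.card_erase_add_one ha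
    have hpos := hne.card_pos
    have hone : ((s.card - 1 : ℕ) : ℝ) - ((s.erase a).card - 1 : ℕ) = 1 := by
      rw [← hcard, Nat.add_sub_cancel, Nat.cast_pred hpos, sub_sub_cancel]
    rw [hone, one_mul]
    exact (h b hb hba).trans hle

theorem le_sumEraseMin_sub_insert (hw : ∀ a, 0 ≤ w a) {b c : ι} (ha : a ∈ s) (hb : b ∈ s)
    (hab : a ≠ b) (hc : c ∉ s \ {a, b}) {d : ℝ} (hd : 0 ≤ d) (hwc : w c = w a + w b - d) :
    d ≤ 2 * (sumEraseMin w s - sumEraseMin w (insert c (s \ {a, b}))) := by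
  have hpair : {a, b} ⊆ s := Finset.insert_subset ha (Finset.singleton_subset_iff.2 hb)
  have hsum : ∑ x ∈ s \ {a, b}, w x + (w a + w b) = ∑ x ∈ s, w x := by
    rw [← Finset.sum_pair hab, Finset.sum_sdiff hpair]
  have hrest : 0 ≤ ∑ x ∈ s \ {a, b}, w x := Finset.sum_nonneg fun x _ => hw x
  have hwithoutA := sum_sub_le_sumEraseMin w ha
  have hwithoutB := sum_sub_le_sumEraseMin w hb
  have hdle : d ≤ w a + w b := by linarith [hw c]
  suffices hle : sumEraseMin w (insert c (s \ {a, b})) ≤ sumEraseMin w s - d / 2 by linarith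
  refine sumEraseMin_le (by linarith) fun x hx => ?_
  rw [Finset.sum_insert hc]
  rcases Finset.mem_insert.1 hx with rfl | hx
  · linarith
  · linarith [sum_sub_le_sumEraseMin w (Finset.mem_sdiff.1 hx).1]

end Amortization

section Colors

variable {α : Type*} {f : α → ℕ} {P : Finset α} {𝒞 : Finset (Finset α)} {κ i : ℕ}
  {A B Q R : Finset α}

/-- The clusters all of whose points have colors in `T`. For `T = {i}` they are called the pure
clusters of color `i`. -/
def clustersWithin (f : α → ℕ) (T : Finset ℕ) (𝒞 : Finset (Finset α)) : Finset (Finset α) :=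
  {Q ∈ 𝒞 | Q.image f ⊆ T}

theorem mem_clustersWithin {T : Finset ℕ} :
    Q ∈ clustersWithin f T 𝒞 ↔ Q ∈ 𝒞 ∧ Q.image f ⊆ T :=
  Finset.mem_filter

theorem mem_clustersWithin_singleton :
    Q ∈ clustersWithin f {i} 𝒞 ↔ Q ∈ 𝒞 ∧ ∀ x ∈ Q, f x = i := by
  simp only [mem_clustersWithin, Finset.image_subset_iff, Finset.mem_singleton]

theorem clustersWithin_sdiff [DecidableEq α] (f : α → ℕ) (T : Finset ℕ)
    (𝒞 𝒟 : Finset (Finset α)) :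
    clustersWithin f T (𝒞 \ 𝒟) = clustersWithin f T 𝒞 \ 𝒟 := by
  ext Q
  simp only [mem_clustersWithin, Finset.mem_sdiff, and_right_comm]

/-- The number of merges within the colors of `T` that are possible before each of these colors
has at most one pure cluster. -/
def excess (f : α → ℕ) (T : Finset ℕ) (𝒞 : Finset (Finset α)) : ℕ :=
  ∑ i ∈ T, ((clustersWithin f {i} 𝒞).card - 1)

/-- The number of colors in `T` with a pure cluster. -/
def numPure (f : α → ℕ) (T : Finset ℕ) (𝒞 : Finset (Finset α)) : ℕ :=
  {i ∈ T | (clustersWithin f {i} 𝒞).Nonempty}.card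

/-- At least half of the points of `Q` have color `i`. -/
def IsMajority (f : α → ℕ) (i : ℕ) (Q : Finset α) : Prop :=
  Q.card ≤ 2 * {x ∈ Q | f x = i}.card

/-- The color `i` and its neighbors; truncated subtraction makes `0` its own predecessor. -/
def near (i : ℕ) : Finset ℕ := Finset.Icc (i - 1) (i + 1)

/-- At least half of the points of `Q` have color `i`, and the others have neighboring colors. -/
def IsCentered (f : α → ℕ) (i : ℕ) (Q : Finset α) : Prop :=
  IsMajority f i Q ∧ Q.image f ⊆ near i

/-- Two different clusters of `𝒞` are centered at the color `i`. While this is the case, merging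
them bounds the cost of a greedy merge. -/
def IsContested (f : α → ℕ) (𝒞 : Finset (Finset α)) (i : ℕ) : Prop :=
  ∃ X ∈ 𝒞, ∃ Y ∈ 𝒞, X ≠ Y ∧ IsCentered f i X ∧ IsCentered f i Y

open Classical in
/-- The contested colors among `0, …, κ - 1`. -/
noncomputable def contestedColors (f : α → ℕ) (κ : ℕ) (𝒞 : Finset (Finset α)) : Finset ℕ :=
  {i ∈ Finset.range κ | IsContested f 𝒞 i}

/-- `Q` contains all points of `P` of color `i` or is centered at `i`. Every cluster belongs to
some color in this sense, and two clusters can belong to the same color only if it is contested. -/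
def BelongsTo (P : Finset α) (f : α → ℕ) (Q : Finset α) (i : ℕ) : Prop :=
  (∀ x ∈ P, f x = i → x ∈ Q) ∨ IsCentered f i Q

theorem mem_contestedColors : i ∈ contestedColors f κ 𝒞 ↔ i < κ ∧ IsContested f 𝒞 i := by
  simp only [contestedColors, Finset.mem_filter, Finset.mem_range]

theorem IsMajority.exists_mem (hm : IsMajority f i Q) (hQ : Q.Nonempty) : ∃ x ∈ Q, f x = i := by
  have hpos := hQ.card_pos
  rw [IsMajority] at hm
  obtain ⟨x, hx⟩ := Finset.card_pos.1 (show 0 < {x ∈ Q | f x = i}.card by omega)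
  exact ⟨x, Finset.mem_filter.1 hx⟩

theorem IsMajority.of_union [DecidableEq α] (hAB : Disjoint A B) (hm : IsMajority f i (A ∪ B)) :
    IsMajority f i A ∨ IsMajority f i B := by
  simp only [IsMajority, Finset.filter_union, Finset.card_union_of_disjoint hAB,
    Finset.card_union_of_disjoint (Finset.disjoint_filter_filter hAB)] at hm ⊢
  omega

theorem BelongsTo.exists_mem (hb : BelongsTo P f Q i) (hQ : Q.Nonempty) (hi : i ∈ P.image f) :
    ∃ x ∈ Q, f x = i := by
  rcases hb with hall | hcentered
  · obtain ⟨x, hx, hxi⟩ := Finset.mem_image.1 hi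
    exact ⟨x, hall x hx hxi, hxi⟩
  · exact hcentered.1.exists_mem hQ

variable [LinearOrder α]

theorem IsIntervalPartition.eq_of_color_lt (h : IsIntervalPartition P 𝒞) (hf : MonotoneOn f P)
    (hA : A ∈ 𝒞) (hB : B ∈ 𝒞) {a a' b b' : α} (ha : a ∈ A) (ha' : a' ∈ A) (hb : b ∈ B)
    (hb' : b' ∈ B) (hlt : f a < f b') (hlt' : f b < f a') : A = B := by
  by_contra hAB
  rcases h.precedes A hA B hB hAB with hprec | hprec
  · exact hlt'.not_ge (hf (h.subset hA ha') (h.subset hB hb) (hprec a' ha' b hb).le)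
  · exact hlt.not_ge (hf (h.subset hB hb') (h.subset hA ha) (hprec b' hb' a ha).le)

theorem exists_belongsTo (h : IsIntervalPartition P 𝒞) (hf : MonotoneOn f P)
    (hrange : P.image f = Finset.range κ) (hQ : Q ∈ 𝒞) : ∃ i < κ, BelongsTo P f Q i := by
  have hlt : ∀ x ∈ Q, f x < κ := fun x hx =>
    Finset.mem_range.1 (hrange ▸ Finset.mem_image_of_mem f (h.subset hQ hx))
  obtain ⟨x, hx, hmin⟩ := Q.exists_min_image f (h.nonempty Q hQ)
  obtain ⟨z, hz, hmax⟩ := Q.exists_max_image f (h.nonempty Q hQ)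
  by_cases hgap : f x + 1 < f z
  · refine ⟨f x + 1, hgap.trans (hlt z hz), .inl fun p hp hpi => ?_⟩
    obtain ⟨R, hR, hpR⟩ := h.exists_mem hp
    rwa [h.eq_of_color_lt hf hQ hR hx hz hpR hpR (by omega) (by omega)]
  have hnear : ∀ i, f x ≤ i → i ≤ f z → Q.image f ⊆ near i := fun i hxi hiz => by
    refine Finset.image_subset_iff.2 fun y hy => Finset.mem_Icc.2 ?_
    have := hmin y hy
    have := hmax y hy
    omega
  by_cases hmaj : IsMajority f (f x) Q
  · exact ⟨f x, hlt x hx, .inr ⟨hmaj, hnear _ le_rfl (hmax x hx)⟩⟩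
  · refine ⟨f z, hlt z hz, .inr ⟨?_, hnear _ (hmin z hz) le_rfl⟩⟩
    have hothers : {y ∈ Q | ¬f y = f x} ⊆ {y ∈ Q | f y = f z} :=
      Finset.monotone_filter_right Q fun y hy hne => by
        have := hmin y hy
        have := hmax y hy
        omega
    have hcard := Finset.card_filter_add_card_filter_not (s := Q) (fun y => f y = f x)
    have := Finset.card_le_card hothers
    rw [IsMajority] at hmaj ⊢
    omega

theorem BelongsTo.isCentered (hb : BelongsTo P f Q i) (h : IsIntervalPartition P 𝒞) (hQ : Q ∈ 𝒞)
    (hR : R ∈ 𝒞) (hne : Q ≠ R) (hx : ∃ x ∈ R, f x = i) : IsCentered f i Q := by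
  refine hb.resolve_left fun hall => ?_
  obtain ⟨x, hx, hxi⟩ := hx
  exact hne (h.eq_of_mem hQ hR (hall x (h.subset hR hx) hxi) hx)

theorem isContested_of_belongsTo (h : IsIntervalPartition P 𝒞) (hi : i ∈ P.image f) (hQ : Q ∈ 𝒞)
    (hR : R ∈ 𝒞) (hne : Q ≠ R) (hbQ : BelongsTo P f Q i) (hbR : BelongsTo P f R i) :
    IsContested f 𝒞 i :=
  ⟨Q, hQ, R, hR, hne, hbQ.isCentered h hQ hR hne (hbR.exists_mem (h.nonempty R hR) hi),
    hbR.isCentered h hR hQ hne.symm (hbQ.exists_mem (h.nonempty Q hQ) hi)⟩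

theorem card_le_two_of_mixed (h : IsIntervalPartition P 𝒞) (hf : MonotoneOn f P)
    {𝒟 : Finset (Finset α)} (hsub : 𝒟 ⊆ 𝒞) (htouch : ∀ Q ∈ 𝒟, ∃ x ∈ Q, f x = i)
    (hmixed : ∀ Q ∈ 𝒟, ∃ x ∈ Q, f x ≠ i) : 𝒟.card ≤ 2 := by
  have hlower : {Q ∈ 𝒟 | ∃ x ∈ Q, f x < i}.card ≤ 1 := by
    refine Finset.card_le_one.2 fun A hA B hB => ?_
    obtain ⟨hA𝒟, a, ha, hai⟩ := Finset.mem_filter.1 hA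
    obtain ⟨hB𝒟, b, hb, hbi⟩ := Finset.mem_filter.1 hB
    obtain ⟨a', ha', hai'⟩ := htouch A hA𝒟
    obtain ⟨b', hb', hbi'⟩ := htouch B hB𝒟
    exact h.eq_of_color_lt hf (hsub hA𝒟) (hsub hB𝒟) ha ha' hb hb' (hbi' ▸ hai) (hai' ▸ hbi)
  have hupper : {Q ∈ 𝒟 | ∃ x ∈ Q, i < f x}.card ≤ 1 := by
    refine Finset.card_le_one.2 fun A hA B hB => ?_
    obtain ⟨hA𝒟, a, ha, hai⟩ := Finset.mem_filter.1 hA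
    obtain ⟨hB𝒟, b, hb, hbi⟩ := Finset.mem_filter.1 hB
    obtain ⟨a', ha', hai'⟩ := htouch A hA𝒟
    obtain ⟨b', hb', hbi'⟩ := htouch B hB𝒟
    exact h.eq_of_color_lt hf (hsub hA𝒟) (hsub hB𝒟) ha' ha hb' hb (hai' ▸ hbi) (hbi' ▸ hai)
  have hcover : 𝒟 ⊆ {Q ∈ 𝒟 | ∃ x ∈ Q, f x < i} ∪ {Q ∈ 𝒟 | ∃ x ∈ Q, i < f x} := fun Q hQ => by
    obtain ⟨x, hx, hne⟩ := hmixed Q hQ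
    rw [Finset.mem_union, Finset.mem_filter, Finset.mem_filter]
    exact hne.lt_or_gt.imp (fun hlt => ⟨hQ, x, hx, hlt⟩) fun hgt => ⟨hQ, x, hx, hgt⟩
  have := Finset.card_le_card hcover
  have := Finset.card_union_le {Q ∈ 𝒟 | ∃ x ∈ Q, f x < i} {Q ∈ 𝒟 | ∃ x ∈ Q, i < f x}
  omega

theorem card_le_card_clustersWithin_add_two (h : IsIntervalPartition P 𝒞) (hf : MonotoneOn f P)
    {𝒟 : Finset (Finset α)} (hsub : 𝒟 ⊆ 𝒞) (htouch : ∀ Q ∈ 𝒟, ∃ x ∈ Q, f x = i) :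
    𝒟.card ≤ (clustersWithin f {i} 𝒞).card + 2 := by
  have hmixed : (𝒟 \ clustersWithin f {i} 𝒞).card ≤ 2 := by
    refine card_le_two_of_mixed h hf (Finset.sdiff_subset.trans hsub)
      (fun Q hQ => htouch Q (Finset.mem_sdiff.1 hQ).1) fun Q hQ => ?_
    obtain ⟨hQ, hnot⟩ := Finset.mem_sdiff.1 hQ
    by_contra! hpure
    exact hnot (mem_clustersWithin_singleton.2 ⟨hsub hQ, hpure⟩)
  have := Finset.card_le_card_sdiff_add_card (s := 𝒟) (t := clustersWithin f {i} 𝒞)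
  omega

theorem card_le_excess_add (h : IsIntervalPartition P 𝒞) (hf : MonotoneOn f P)
    (hrange : P.image f = Finset.range κ) :
    𝒞.card ≤ excess f (Finset.range κ) 𝒞 + κ + 2 * (contestedColors f κ 𝒞).card := by
  classical
  choose! home hlt hhome using fun Q (hQ : Q ∈ 𝒞) => exists_belongsTo h hf hrange hQ
  rw [Finset.card_eq_sum_card_fiberwise (t := Finset.range κ)
    fun Q hQ => Finset.mem_coe.2 (Finset.mem_range.2 (hlt Q hQ))]
  calc ∑ i ∈ Finset.range κ, {Q ∈ 𝒞 | home Q = i}.card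
      ≤ ∑ i ∈ Finset.range κ, ((clustersWithin f {i} 𝒞).card - 1 + 1 +
          2 * if IsContested f 𝒞 i then 1 else 0) := Finset.sum_le_sum fun i hi => ?_
    _ = excess f (Finset.range κ) 𝒞 + κ + 2 * (contestedColors f κ 𝒞).card := by
      rw [contestedColors, Finset.card_filter, excess, Finset.sum_add_distrib,
        Finset.sum_add_distrib, Finset.mul_sum, Finset.sum_const, Finset.card_range, smul_eq_mul,
        mul_one]
  have hfiber : ∀ Q ∈ ({Q ∈ 𝒞 | home Q = i} : Finset _), Q ∈ 𝒞 ∧ BelongsTo P f Q i := fun Q hQ => by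
    obtain ⟨hQ𝒞, hQi⟩ := Finset.mem_filter.1 hQ
    exact ⟨hQ𝒞, hQi ▸ hhome Q hQ𝒞⟩
  rw [← hrange] at hi
  split_ifs with hcontested
  · have := card_le_card_clustersWithin_add_two h hf (Finset.filter_subset _ _) fun Q hQ =>
      (hfiber Q hQ).2.exists_mem (h.nonempty Q (hfiber Q hQ).1) hi
    omega
  · have : {Q ∈ 𝒞 | home Q = i}.card ≤ 1 := by
      refine Finset.card_le_one.2 fun X hX Y hY => ?_
      by_contra hne
      exact hcontested (isContested_of_belongsTo h hi (hfiber X hX).1 (hfiber Y hY).1 hne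
        (hfiber X hX).2 (hfiber Y hY).2)
    omega

end Colors

section Merge

variable {P : Finset ℝ} {𝒞 : Finset (Finset ℝ)} {A B C X Y : Finset ℝ}

theorem mem_merge : X ∈ merge 𝒞 A B ↔ X = A ∪ B ∨ X ∈ 𝒞 ∧ X ≠ A ∧ X ≠ B := by
  simp only [merge, Finset.mem_insert, Finset.mem_sdiff, Finset.mem_singleton, not_or]

theorem union_mem_merge (𝒞 : Finset (Finset ℝ)) (A B : Finset ℝ) : A ∪ B ∈ merge 𝒞 A B :=
  Finset.mem_insert_self _ _

theorem pair_subset (hA : A ∈ 𝒞) (hB : B ∈ 𝒞) : {A, B} ⊆ 𝒞 :=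
  Finset.insert_subset hA (Finset.singleton_subset_iff.2 hB)

theorem card_merge (hA : A ∈ 𝒞) (hB : B ∈ 𝒞) (hAB : A ≠ B) (hU : A ∪ B ∉ 𝒞 \ {A, B}) :
    (merge 𝒞 A B).card + 1 = 𝒞.card := by
  have hcard := Finset.card_sdiff_add_card_eq_card (pair_subset hA hB)
  rw [Finset.card_pair hAB] at hcard
  rw [merge, Finset.card_insert_of_notMem hU, hcard]

theorem sum_cost_merge (hA : A ∈ 𝒞) (hB : B ∈ 𝒞) (hAB : A ≠ B) (hU : A ∪ B ∉ 𝒞 \ {A, B}) :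
    ∑ Q ∈ merge 𝒞 A B, cost Q = ∑ Q ∈ 𝒞, cost Q + mergeCost A B := by
  rw [merge, Finset.sum_insert hU, ← Finset.sum_sdiff (pair_subset hA hB), Finset.sum_pair hAB,
    mergeCost]
  ring

namespace IsGreedyMerge

theorem symm (hg : IsGreedyMerge 𝒞 A B) : IsGreedyMerge 𝒞 B A :=
  let ⟨hA, hB, hAB, hmin⟩ := hg
  ⟨hB, hA, hAB.symm, mergeCost_comm A B ▸ hmin⟩

theorem disjoint (hg : IsGreedyMerge 𝒞 A B) (h : IsIntervalPartition P 𝒞) : Disjoint A B :=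
  h.disjoint hg.1 hg.2.1 hg.2.2.1

theorem not_between (hg : IsGreedyMerge 𝒞 A B) (h : IsIntervalPartition P 𝒞) (hC : C ∈ 𝒞)
    (hCA : C ≠ A) (hCB : C ≠ B) (hAC : Precedes A C) : ¬Precedes C B := by
  obtain ⟨hA, hB, -, hmin⟩ := hg
  intro hprec
  rcases mergeCost_lt_or_lt_of_between (h.nonempty A hA) (h.nonempty B hB) (h.nonempty C hC) hAC
    hprec with hlt | hlt
  · exact hlt.not_ge (hmin A hA C hC hCA.symm)
  · exact hlt.not_ge (hmin C hC B hB hCB)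

theorem precedes_union (hg : IsGreedyMerge 𝒞 A B) (h : IsIntervalPartition P 𝒞) (hC : C ∈ 𝒞)
    (hCA : C ≠ A) (hCB : C ≠ B) : Precedes (A ∪ B) C ∨ Precedes C (A ∪ B) := by
  rcases h.precedes A hg.1 C hC hCA.symm with hAC | hAC <;>
    rcases h.precedes B hg.2.1 C hC hCB.symm with hBC | hBC
  · exact .inl (hAC.union_left hBC)
  · exact absurd hBC (hg.not_between h hC hCA hCB hAC)
  · exact absurd hAC (hg.symm.not_between h hC hCB hCA hBC)
  · exact .inr (hAC.union_right hBC)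

theorem isIntervalPartition_merge (hg : IsGreedyMerge 𝒞 A B) (h : IsIntervalPartition P 𝒞) :
    IsIntervalPartition P (merge 𝒞 A B) where
  nonempty Q hQ := by
    rcases mem_merge.1 hQ with rfl | ⟨hQ, -, -⟩
    · exact (h.nonempty A hg.1).mono Finset.subset_union_left
    · exact h.nonempty Q hQ
  biUnion_eq := by
    rw [← h.biUnion_eq, merge, Finset.biUnion_insert]
    conv_rhs => rw [← Finset.sdiff_union_of_subset (pair_subset hg.1 hg.2.1)]
    rw [Finset.union_biUnion, Finset.biUnion_insert, Finset.singleton_biUnion, Finset.union_comm]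
    rfl
  precedes X hX Y hY hne := by
    rcases mem_merge.1 hX with rfl | ⟨hX, hXA, hXB⟩ <;>
      rcases mem_merge.1 hY with rfl | ⟨hY, hYA, hYB⟩
    · exact absurd rfl hne
    · exact hg.precedes_union h hY hYA hYB
    · exact (hg.precedes_union h hX hXA hXB).symm
    · exact h.precedes X hX Y hY hne

theorem le_of_merge (hg : IsGreedyMerge 𝒞 A B) (h : IsIntervalPartition P 𝒞)
    (hX : X ∈ merge 𝒞 A B) (hY : Y ∈ merge 𝒞 A B) (hne : X ≠ Y) :
    mergeCost A B ≤ mergeCost X Y := by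
  have hnew : ∀ Z ∈ 𝒞, Z ≠ A → Z ≠ B → mergeCost A B ≤ mergeCost (A ∪ B) Z := fun Z hZ hZA hZB =>
    mergeCost_le_mergeCost_union (hg.disjoint h) (h.disjoint hg.1 hZ hZA.symm)
      (h.disjoint hg.2.1 hZ hZB.symm) (h.nonempty A hg.1) (hg.2.2.2 A hg.1 Z hZ hZA.symm)
      (hg.2.2.2 B hg.2.1 Z hZ hZB.symm)
  rcases mem_merge.1 hX with rfl | ⟨hX, hXA, hXB⟩ <;>
    rcases mem_merge.1 hY with rfl | ⟨hY, hYA, hYB⟩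
  · exact absurd rfl hne
  · exact hnew Y hY hYA hYB
  · rw [mergeCost_comm X]
    exact hnew X hX hXA hXB
  · exact hg.2.2.2 X hX Y hY hne

end IsGreedyMerge

variable {f : ℝ → ℕ} {T : Finset ℕ} {i : ℕ}

theorem clustersWithin_merge_of_subset (hT : (A ∪ B).image f ⊆ T) :
    clustersWithin f T (merge 𝒞 A B) = merge (clustersWithin f T 𝒞) A B := by
  rw [clustersWithin, merge, Finset.filter_insert, if_pos hT, ← clustersWithin,
    clustersWithin_sdiff, merge]

theorem clustersWithin_merge_of_not_subset (hT : ¬(A ∪ B).image f ⊆ T) :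
    clustersWithin f T (merge 𝒞 A B) = clustersWithin f T 𝒞 \ {A, B} := by
  rw [clustersWithin, merge, Finset.filter_insert, if_neg hT, ← clustersWithin,
    clustersWithin_sdiff]

theorem mem_clustersWithin_of_union (hA : A ∈ 𝒞) (hB : B ∈ 𝒞) (hT : (A ∪ B).image f ⊆ T) :
    A ∈ clustersWithin f T 𝒞 ∧ B ∈ clustersWithin f T 𝒞 := by
  rw [Finset.image_union, Finset.union_subset_iff] at hT
  exact ⟨mem_clustersWithin.2 ⟨hA, hT.1⟩, mem_clustersWithin.2 ⟨hB, hT.2⟩⟩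

theorem union_notMem_clustersWithin_sdiff (h : IsIntervalPartition P 𝒞) (hA : A ∈ 𝒞)
    (B : Finset ℝ) (f : ℝ → ℕ) (T : Finset ℕ) : A ∪ B ∉ clustersWithin f T 𝒞 \ {A, B} :=
  fun hmem => h.union_notMem_sdiff hA B
    (Finset.sdiff_subset_sdiff (Finset.filter_subset _ _) subset_rfl hmem)

theorem card_clustersWithin_merge_lt (hA : A ∈ 𝒞) (hB : B ∈ 𝒞) (hAB : A ≠ B)
    (hmem : A ∈ clustersWithin f T 𝒞 ∨ B ∈ clustersWithin f T 𝒞) :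
    (clustersWithin f T (merge 𝒞 A B)).card < (clustersWithin f T 𝒞).card := by
  by_cases hT : (A ∪ B).image f ⊆ T
  · obtain ⟨hAT, hBT⟩ := mem_clustersWithin_of_union hA hB hT
    have hcard := Finset.card_sdiff_add_card_eq_card (pair_subset hAT hBT)
    rw [Finset.card_pair hAB] at hcard
    rw [clustersWithin_merge_of_subset hT, merge, ← hcard]
    exact (Finset.card_insert_le _ _).trans_lt (Nat.lt_succ_self _)
  · rw [clustersWithin_merge_of_not_subset hT]
    refine Finset.card_lt_card (sdiff_lt_left.2 (Finset.not_disjoint_iff.2 ?_))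
    exact hmem.elim (fun hA => ⟨A, by simp, hA⟩) fun hB => ⟨B, by simp, hB⟩

theorem card_clustersWithin_merge_le (hA : A ∈ 𝒞) (hB : B ∈ 𝒞) (hAB : A ≠ B) (f : ℝ → ℕ)
    (T : Finset ℕ) : (clustersWithin f T (merge 𝒞 A B)).card ≤ (clustersWithin f T 𝒞).card := by
  by_cases hT : (A ∪ B).image f ⊆ T
  · exact (card_clustersWithin_merge_lt hA hB hAB
      (.inl (mem_clustersWithin_of_union hA hB hT).1)).le
  · rw [clustersWithin_merge_of_not_subset hT]
    exact Finset.card_le_card Finset.sdiff_subset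

theorem numPure_merge_le (hA : A ∈ 𝒞) (hB : B ∈ 𝒞) (hAB : A ≠ B) (f : ℝ → ℕ) (T : Finset ℕ) :
    numPure f T (merge 𝒞 A B) ≤ numPure f T 𝒞 :=
  Finset.card_le_card <| Finset.monotone_filter_right T fun i _ hi => Finset.card_pos.1 <|
    hi.card_pos.trans_le (card_clustersWithin_merge_le hA hB hAB f {i})

theorem excess_merge_lt_or_numPure_merge_lt (hA : A ∈ 𝒞) (hB : B ∈ 𝒞) (hAB : A ≠ B) (hi : i ∈ T)
    (hmem : A ∈ clustersWithin f {i} 𝒞 ∨ B ∈ clustersWithin f {i} 𝒞) :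
    excess f T (merge 𝒞 A B) < excess f T 𝒞 ∨ numPure f T (merge 𝒞 A B) < numPure f T 𝒞 := by
  have hlt := card_clustersWithin_merge_lt hA hB hAB hmem
  by_cases hcard : 2 ≤ (clustersWithin f {i} 𝒞).card
  · exact .inl <| Finset.sum_lt_sum
      (fun j _ => Nat.sub_le_sub_right (card_clustersWithin_merge_le hA hB hAB f {j}) 1)
      ⟨i, hi, by omega⟩
  · refine .inr <| Finset.card_lt_card <| Finset.ssubset_iff_subset_ne.2
      ⟨Finset.monotone_filter_right T fun j _ hj => Finset.card_pos.1 <|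
        hj.card_pos.trans_le (card_clustersWithin_merge_le hA hB hAB f {j}), fun heq => ?_⟩
    have hpure : i ∈ {j ∈ T | (clustersWithin f {j} (merge 𝒞 A B)).Nonempty} :=
      heq ▸ Finset.mem_filter.2 ⟨hi, Finset.card_pos.1 (by omega)⟩
    have := (Finset.mem_filter.1 hpure).2.card_pos
    omega

theorem exists_isCentered_of_merge (hA : A ∈ 𝒞) (hB : B ∈ 𝒞) (hAB : Disjoint A B)
    (hX : X ∈ merge 𝒞 A B) (hc : IsCentered f i X) : ∃ Y ∈ 𝒞, Y ⊆ X ∧ IsCentered f i Y := by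
  rcases mem_merge.1 hX with rfl | ⟨hX, -, -⟩
  · obtain ⟨hmaj, hnear⟩ := hc
    rw [Finset.image_union, Finset.union_subset_iff] at hnear
    rcases hmaj.of_union hAB with hmaj | hmaj
    · exact ⟨A, hA, Finset.subset_union_left, hmaj, hnear.1⟩
    · exact ⟨B, hB, Finset.subset_union_right, hmaj, hnear.2⟩
  · exact ⟨X, hX, subset_rfl, hc⟩

theorem IsContested.of_merge (hi : IsContested f (merge 𝒞 A B) i) (h : IsIntervalPartition P 𝒞)
    (hg : IsGreedyMerge 𝒞 A B) : IsContested f 𝒞 i := by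
  obtain ⟨X, hX, Y, hY, hne, hXc, hYc⟩ := hi
  have hAB := hg.disjoint h
  obtain ⟨X', hX', hsubX, hXc'⟩ := exists_isCentered_of_merge hg.1 hg.2.1 hAB hX hXc
  obtain ⟨Y', hY', hsubY, hYc'⟩ := exists_isCentered_of_merge hg.1 hg.2.1 hAB hY hYc
  refine ⟨X', hX', Y', hY', ?_, hXc', hYc'⟩
  rintro rfl
  obtain ⟨x, hx⟩ := h.nonempty X' hX'
  exact hne ((hg.isIntervalPartition_merge h).eq_of_mem hX hY (hsubX hx) (hsubY hx))

theorem contestedColors_merge_subset (h : IsIntervalPartition P 𝒞) (hg : IsGreedyMerge 𝒞 A B)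
    (f : ℝ → ℕ) (κ : ℕ) : contestedColors f κ (merge 𝒞 A B) ⊆ contestedColors f κ 𝒞 :=
  fun _ hi => mem_contestedColors.2 <|
    (mem_contestedColors.1 hi).imp_right fun hc => hc.of_merge h hg

theorem exists_color_lt (hA : A ∈ 𝒞) (hne : A.Nonempty)
    (hmixed : ∀ j, A ∉ clustersWithin f {j} 𝒞) : ∃ x ∈ A, ∃ y ∈ A, f x < f y := by
  obtain ⟨x, hx⟩ := hne
  have hother : ∃ y ∈ A, f y ≠ f x := by
    by_contra! hpure
    exact hmixed _ (mem_clustersWithin_singleton.2 ⟨hA, hpure⟩)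
  obtain ⟨y, hy, hxy⟩ := hother
  exact hxy.lt_or_gt.elim (fun hlt => ⟨y, hy, x, hx, hlt⟩) fun hlt => ⟨x, hx, y, hy, hlt⟩

theorem exists_color_lt_and_lt (h : IsIntervalPartition P 𝒞) (hf : MonotoneOn f P) (hA : A ∈ 𝒞)
    (hB : B ∈ 𝒞) (hAB : A ≠ B) (hmixedA : ∀ j, A ∉ clustersWithin f {j} 𝒞)
    (hmixedB : ∀ j, B ∉ clustersWithin f {j} 𝒞) (hnear : (A ∪ B).image f ⊆ near i) :
    ∃ x ∈ A ∪ B, ∃ y ∈ A ∪ B, f x < i ∧ i < f y := by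
  obtain ⟨a, ha, a', ha', hlta⟩ := exists_color_lt hA (h.nonempty A hA) hmixedA
  obtain ⟨b, hb, b', hb', hltb⟩ := exists_color_lt hB (h.nonempty B hB) hmixedB
  have hcolor : ∀ x ∈ A ∪ B, i - 1 ≤ f x ∧ f x ≤ i + 1 := fun x hx =>
    Finset.mem_Icc.1 (hnear (Finset.mem_image_of_mem f hx))
  have haU := Finset.mem_union_left B ha
  have haU' := Finset.mem_union_left B ha'
  have hbU := Finset.mem_union_right A hb
  have hbU' := Finset.mem_union_right A hb'
  have := hcolor a haU
  have := hcolor a' haU'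
  have := hcolor b hbU
  have := hcolor b' hbU'
  rcases le_or_gt (f b') (f a) with hle | hlt
  · exact ⟨b, hbU, a', haU', by omega, by omega⟩
  · have hle : f a' ≤ f b := not_lt.1 fun hlt' =>
      hAB (h.eq_of_color_lt hf hA hB ha ha' hb hb' hlt hlt')
    exact ⟨a, haU, b', hbU', by omega, by omega⟩

theorem not_isContested_merge (h : IsIntervalPartition P 𝒞) (hf : MonotoneOn f P)
    (hg : IsGreedyMerge 𝒞 A B) (hmixedA : ∀ j, A ∉ clustersWithin f {j} 𝒞)
    (hmixedB : ∀ j, B ∉ clustersWithin f {j} 𝒞) (hnear : (A ∪ B).image f ⊆ near i) :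
    ¬IsContested f (merge 𝒞 A B) i := by
  have h' := hg.isIntervalPartition_merge h
  obtain ⟨x, hx, y, hy, hxi, hiy⟩ :=
    exists_color_lt_and_lt h hf hg.1 hg.2.1 hg.2.2.1 hmixedA hmixedB hnear
  have hswallow : ∀ X ∈ merge 𝒞 A B, IsCentered f i X → A ∪ B = X := fun X hX hXc => by
    obtain ⟨z, hz, rfl⟩ := hXc.1.exists_mem (h'.nonempty X hX)
    exact h'.eq_of_color_lt hf (union_mem_merge 𝒞 A B) hX hx hy hz hz hxi hiy
  rintro ⟨X, hX, Y, hY, hne, hXc, hYc⟩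
  exact hne ((hswallow X hX hXc).symm.trans (hswallow Y hY hYc))

end Merge

section Potential

variable {P : Finset ℝ} {𝒞 : Finset (Finset ℝ)} {A B : Finset ℝ} {f : ℝ → ℕ} {T : Finset ℕ}

/-- The cost of the points with colors in `T`, where `c` assigns a center to each color. -/
noncomputable def colorCost (P : Finset ℝ) (f : ℝ → ℕ) (c : ℕ → ℝ) (T : Finset ℕ) : ℝ :=
  ∑ i ∈ T, costAt {x ∈ P | f x = i} (c i)

/-- For each color in `T`, the shift costs of its pure clusters except the smallest one. Twice
this amount pays for the merges counted by `excess`. -/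
noncomputable def potential (f : ℝ → ℕ) (c : ℕ → ℝ) (T : Finset ℕ) (𝒞 : Finset (Finset ℝ)) : ℝ :=
  ∑ i ∈ T, sumEraseMin (shiftCost (c i)) (clustersWithin f {i} 𝒞)

/-- The cost of the clusters with colors in `T`, plus what the potential still has to pay for. -/
noncomputable def localCost (f : ℝ → ℕ) (c : ℕ → ℝ) (T : Finset ℕ) (𝒞 : Finset (Finset ℝ)) : ℝ :=
  ∑ Q ∈ clustersWithin f T 𝒞, cost Q + 2 * potential f c T 𝒞

theorem colorCost_nonneg (P : Finset ℝ) (f : ℝ → ℕ) (c : ℕ → ℝ) (T : Finset ℕ) :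
    0 ≤ colorCost P f c T :=
  Finset.sum_nonneg fun _ _ => costAt_nonneg _ _

theorem potential_nonneg (f : ℝ → ℕ) (c : ℕ → ℝ) (T : Finset ℕ) (𝒞 : Finset (Finset ℝ)) :
    0 ≤ potential f c T 𝒞 :=
  Finset.sum_nonneg fun _ _ => sumEraseMin_nonneg (shiftCost_nonneg _) _

theorem localCost_nonneg (f : ℝ → ℕ) (c : ℕ → ℝ) (T : Finset ℕ) (𝒞 : Finset (Finset ℝ)) :
    0 ≤ localCost f c T 𝒞 :=
  add_nonneg (Finset.sum_nonneg fun Q _ => cost_nonneg Q)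
    (mul_nonneg zero_le_two (potential_nonneg f c T 𝒞))

theorem IsGreedyMerge.le_shiftCost_add (hg : IsGreedyMerge 𝒞 A B) (h : IsIntervalPartition P 𝒞)
    {X Y : Finset ℝ} (hX : X ∈ 𝒞) (hY : Y ∈ 𝒞) (hne : X ≠ Y) (c : ℝ) :
    mergeCost A B ≤ shiftCost c X + shiftCost c Y :=
  (hg.2.2.2 X hX Y hY hne).trans (mergeCost_le_shiftCost_add (h.disjoint hX hY hne) c)

theorem excess_mul_mergeCost_le (h : IsIntervalPartition P 𝒞) (hg : IsGreedyMerge 𝒞 A B)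
    (f : ℝ → ℕ) (c : ℕ → ℝ) (T : Finset ℕ) :
    excess f T 𝒞 * mergeCost A B ≤ 2 * potential f c T 𝒞 := by
  rw [excess, potential, Nat.cast_sum, Finset.sum_mul, Finset.mul_sum]
  exact Finset.sum_le_sum fun i _ => card_sub_one_mul_le_sumEraseMin (shiftCost_nonneg _)
    fun X hX Y hY hne =>
      hg.le_shiftCost_add h (mem_clustersWithin.1 hX).1 (mem_clustersWithin.1 hY).1 hne _

theorem card_sub_card_merge_mul_mergeCost_le (h : IsIntervalPartition P 𝒞)
    (hg : IsGreedyMerge 𝒞 A B) (f : ℝ → ℕ) (c : ℝ) (T : Finset ℕ) :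
    ((((clustersWithin f T 𝒞).card - 1 : ℕ) : ℝ) -
        ((clustersWithin f T (merge 𝒞 A B)).card - 1 : ℕ)) * mergeCost A B ≤
      2 * (sumEraseMin (shiftCost c) (clustersWithin f T 𝒞) -
        sumEraseMin (shiftCost c) (clustersWithin f T (merge 𝒞 A B))) := by
  obtain ⟨hA, hB, hAB, -⟩ := id hg
  have hdisj := hg.disjoint h
  by_cases hT : (A ∪ B).image f ⊆ T
  · obtain ⟨hAT, hBT⟩ := mem_clustersWithin_of_union hA hB hT
    have hU := union_notMem_clustersWithin_sdiff h hA B f T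
    have hcard := card_merge hAT hBT hAB hU
    have hpos := Finset.card_pos.2 ⟨A ∪ B, union_mem_merge (clustersWithin f T 𝒞) A B⟩
    rw [clustersWithin_merge_of_subset hT, ← hcard, Nat.add_sub_cancel, Nat.cast_pred hpos,
      sub_sub_cancel, one_mul]
    exact le_sumEraseMin_sub_insert (shiftCost_nonneg c) hAT hBT hAB hU (mergeCost_nonneg hdisj)
      (shiftCost_union hdisj c)
  · rw [clustersWithin_merge_of_not_subset hT, Finset.sdiff_insert,
      Finset.sdiff_singleton_eq_erase]
    have hremoveB := card_sub_card_erase_mul_le_sumEraseMin_sub (shiftCost_nonneg c)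
      (s := clustersWithin f T 𝒞) fun X hX hXB =>
        hg.le_shiftCost_add h hB (mem_clustersWithin.1 hX).1 hXB.symm c
    have hremoveA := card_sub_card_erase_mul_le_sumEraseMin_sub (shiftCost_nonneg c)
      (s := (clustersWithin f T 𝒞).erase B) fun X hX hXA =>
        hg.le_shiftCost_add h hA (mem_clustersWithin.1 (Finset.mem_of_mem_erase hX)).1 hXA.symm c
    linarith

theorem excess_sub_mul_mergeCost_le (h : IsIntervalPartition P 𝒞) (hg : IsGreedyMerge 𝒞 A B)
    (f : ℝ → ℕ) (c : ℕ → ℝ) (T : Finset ℕ) :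
    ((excess f T 𝒞 : ℝ) - excess f T (merge 𝒞 A B)) * mergeCost A B ≤
      2 * (potential f c T 𝒞 - potential f c T (merge 𝒞 A B)) := by
  rw [excess, excess, potential, potential, Nat.cast_sum, Nat.cast_sum,
    ← Finset.sum_sub_distrib, ← Finset.sum_sub_distrib, Finset.sum_mul, Finset.mul_sum]
  exact Finset.sum_le_sum fun i _ => card_sub_card_merge_mul_mergeCost_le h hg f (c i) {i}

theorem excess_merge_le (hA : A ∈ 𝒞) (hB : B ∈ 𝒞) (hAB : A ≠ B) (f : ℝ → ℕ) (T : Finset ℕ) :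
    excess f T (merge 𝒞 A B) ≤ excess f T 𝒞 :=
  Finset.sum_le_sum fun i _ =>
    Nat.sub_le_sub_right (card_clustersWithin_merge_le hA hB hAB f {i}) 1

theorem potential_merge_le (h : IsIntervalPartition P 𝒞) (hg : IsGreedyMerge 𝒞 A B)
    (f : ℝ → ℕ) (c : ℕ → ℝ) (T : Finset ℕ) :
    potential f c T (merge 𝒞 A B) ≤ potential f c T 𝒞 := by
  have hexcess : (excess f T (merge 𝒞 A B) : ℝ) ≤ excess f T 𝒞 :=
    Nat.cast_le.2 (excess_merge_le hg.1 hg.2.1 hg.2.2.1 f T)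
  have hpaid := mul_nonneg (sub_nonneg.2 hexcess) (mergeCost_nonneg (hg.disjoint h))
  linarith [excess_sub_mul_mergeCost_le h hg f c T]

theorem mergeCost_le_of_excess_lt (h : IsIntervalPartition P 𝒞) (hg : IsGreedyMerge 𝒞 A B)
    (c : ℕ → ℝ) (hlt : excess f T (merge 𝒞 A B) < excess f T 𝒞) :
    mergeCost A B ≤ 2 * (potential f c T 𝒞 - potential f c T (merge 𝒞 A B)) := by
  have hexcess : (excess f T (merge 𝒞 A B) : ℝ) + 1 ≤ excess f T 𝒞 := mod_cast hlt
  exact (le_mul_of_one_le_left (mergeCost_nonneg (hg.disjoint h)) (by linarith)).trans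
    (excess_sub_mul_mergeCost_le h hg f c T)

theorem sum_cost_clustersWithin_merge_of_subset (h : IsIntervalPartition P 𝒞) (hA : A ∈ 𝒞)
    (hB : B ∈ 𝒞) (hAB : A ≠ B) (hT : (A ∪ B).image f ⊆ T) :
    ∑ Q ∈ clustersWithin f T (merge 𝒞 A B), cost Q =
      ∑ Q ∈ clustersWithin f T 𝒞, cost Q + mergeCost A B := by
  obtain ⟨hAT, hBT⟩ := mem_clustersWithin_of_union hA hB hT
  rw [clustersWithin_merge_of_subset hT]
  exact sum_cost_merge hAT hBT hAB (union_notMem_clustersWithin_sdiff h hA B f T)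

theorem sum_cost_clustersWithin_merge_le_of_not_subset (hT : ¬(A ∪ B).image f ⊆ T) :
    ∑ Q ∈ clustersWithin f T (merge 𝒞 A B), cost Q ≤ ∑ Q ∈ clustersWithin f T 𝒞, cost Q := by
  rw [clustersWithin_merge_of_not_subset hT]
  exact Finset.sum_le_sum_of_subset_of_nonneg Finset.sdiff_subset fun Q _ _ => cost_nonneg Q

theorem localCost_merge_le (h : IsIntervalPartition P 𝒞) (hg : IsGreedyMerge 𝒞 A B)
    (f : ℝ → ℕ) (c : ℕ → ℝ) (T : Finset ℕ) :
    localCost f c T (merge 𝒞 A B) ≤ localCost f c T 𝒞 + mergeCost A B := by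
  have hpotential := potential_merge_le h hg f c T
  rw [localCost, localCost]
  by_cases hT : (A ∪ B).image f ⊆ T
  · linarith [sum_cost_clustersWithin_merge_of_subset h hg.1 hg.2.1 hg.2.2.1 hT]
  · linarith [sum_cost_clustersWithin_merge_le_of_not_subset (𝒞 := 𝒞) hT,
      mergeCost_nonneg (hg.disjoint h)]

theorem localCost_merge_le_self (h : IsIntervalPartition P 𝒞) (hg : IsGreedyMerge 𝒞 A B)
    (c : ℕ → ℝ)
    (hexcess : (A ∪ B).image f ⊆ T → excess f T (merge 𝒞 A B) < excess f T 𝒞) :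
    localCost f c T (merge 𝒞 A B) ≤ localCost f c T 𝒞 := by
  rw [localCost, localCost]
  by_cases hT : (A ∪ B).image f ⊆ T
  · linarith [sum_cost_clustersWithin_merge_of_subset h hg.1 hg.2.1 hg.2.2.1 hT,
      mergeCost_le_of_excess_lt h hg c (hexcess hT)]
  · linarith [sum_cost_clustersWithin_merge_le_of_not_subset (𝒞 := 𝒞) hT,
      potential_merge_le h hg f c T]

theorem clustersWithin_image_singleton (P : Finset ℝ) (f : ℝ → ℕ) (T : Finset ℕ) :
    clustersWithin f T (P.image fun x => {x}) = {x ∈ P | f x ∈ T}.image fun x => {x} := by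
  simp only [clustersWithin, Finset.filter_image, Finset.image_singleton,
    Finset.singleton_subset_iff]

theorem potential_image_singleton_le (P : Finset ℝ) (f : ℝ → ℕ) (c : ℕ → ℝ) (T : Finset ℕ) :
    potential f c T (P.image fun x => {x}) ≤ colorCost P f c T := by
  refine Finset.sum_le_sum fun i _ =>
    (sumEraseMin_le_sum (shiftCost_nonneg _) _).trans_eq ?_
  rw [clustersWithin_image_singleton, Finset.sum_image Finset.singleton_injective.injOn]
  simp only [shiftCost_singleton, costAt, Finset.mem_singleton]

theorem localCost_image_singleton_le (P : Finset ℝ) (f : ℝ → ℕ) (c : ℕ → ℝ) (T : Finset ℕ) :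
    localCost f c T (P.image fun x => {x}) ≤ 2 * colorCost P f c T := by
  rw [localCost, clustersWithin_image_singleton,
    Finset.sum_image Finset.singleton_injective.injOn]
  simp only [cost_singleton, Finset.sum_const_zero, zero_add]
  linarith [potential_image_singleton_le P f c T]

end Potential

section LocalBudget

variable {P : Finset ℝ} {𝒞 : Finset (Finset ℝ)} {A B Q : Finset ℝ} {f : ℝ → ℕ} {i : ℕ}

/-- A bound on the local cost around `i` that does not increase during a run as long as `i` is
contested. A merge near `i` that the potential does not pay for costs at most four times the
second factor, but exhausts the pure clusters of a color near `i`. -/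
noncomputable def localBudget (P : Finset ℝ) (f : ℝ → ℕ) (c : ℕ → ℝ) (i : ℕ)
    (𝒞 : Finset (Finset ℝ)) : ℝ :=
  5 ^ numPure f (near i) 𝒞 * (colorCost P f c (near i) + localCost f c (near i) 𝒞)

theorem shiftCost_le_of_isMajority (hQ : IsMajority f i Q) (c : ℝ) :
    shiftCost c Q ≤ 4 * cost Q + 4 * costAt {x ∈ Q | f x = i} c := by
  have hcard : (Q.card : ℝ) ≤ 2 * {x ∈ Q | f x = i}.card := mod_cast hQ
  have hmajority : {x ∈ Q | f x = i}.card * (centroid Q - c) ^ 2 ≤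
      2 * costAt {x ∈ Q | f x = i} (centroid Q) + 2 * costAt {x ∈ Q | f x = i} c := by
    simp only [costAt]
    rw [← nsmul_eq_mul, Finset.mul_sum, Finset.mul_sum, ← Finset.sum_add_distrib]
    refine Finset.card_nsmul_le_sum _ _ _ fun x _ => ?_
    linarith [sq_nonneg ((x - centroid Q) + (x - c))]
  have hsub : costAt {x ∈ Q | f x = i} (centroid Q) ≤ cost Q :=
    costAt_mono (Finset.filter_subset _ _) _
  calc shiftCost c Q
      ≤ 2 * {x ∈ Q | f x = i}.card * (centroid Q - c) ^ 2 := by rw [shiftCost]; gcongr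
    _ ≤ 4 * cost Q + 4 * costAt {x ∈ Q | f x = i} c := by linarith

theorem mergeCost_le_of_isContested (h : IsIntervalPartition P 𝒞) (hg : IsGreedyMerge 𝒞 A B)
    (c : ℕ → ℝ) (hi : IsContested f 𝒞 i) :
    mergeCost A B ≤ 4 * (colorCost P f c (near i) + localCost f c (near i) 𝒞) := by
  obtain ⟨X, hX, Y, hY, hne, ⟨hXmaj, hXnear⟩, hYmaj, hYnear⟩ := hi
  have hdisj := h.disjoint hX hY hne
  have hcolor : costAt {x ∈ X | f x = i} (c i) + costAt {x ∈ Y | f x = i} (c i) ≤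
      colorCost P f c (near i) := by
    rw [← costAt_union (Finset.disjoint_filter_filter hdisj), ← Finset.filter_union]
    refine (costAt_mono (Finset.filter_subset_filter _
      (Finset.union_subset (h.subset hX) (h.subset hY))) _).trans ?_
    exact Finset.single_le_sum (f := fun j => costAt {x ∈ P | f x = j} (c j))
      (fun j _ => costAt_nonneg _ _) (Finset.mem_Icc.2 ⟨Nat.sub_le i 1, Nat.le_succ i⟩)
  have hcost : cost X + cost Y ≤ ∑ Q ∈ clustersWithin f (near i) 𝒞, cost Q := by
    rw [← Finset.sum_pair hne]
    exact Finset.sum_le_sum_of_subset_of_nonneg (pair_subset (mem_clustersWithin.2 ⟨hX, hXnear⟩)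
      (mem_clustersWithin.2 ⟨hY, hYnear⟩)) fun Q _ _ => cost_nonneg Q
  have hpotential := potential_nonneg f c (near i) 𝒞
  rw [localCost]
  linarith [hg.le_shiftCost_add h hX hY hne (c i), shiftCost_le_of_isMajority hXmaj (c i),
    shiftCost_le_of_isMajority hYmaj (c i)]

theorem mergeCost_le_localBudget (h : IsIntervalPartition P 𝒞) (hg : IsGreedyMerge 𝒞 A B)
    (c : ℕ → ℝ) (hi : IsContested f 𝒞 i) : mergeCost A B ≤ 4 * localBudget P f c i 𝒞 := by
  refine (mergeCost_le_of_isContested h hg c hi).trans (mul_le_mul_of_nonneg_left ?_ zero_le_four)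
  exact le_mul_of_one_le_left (add_nonneg (colorCost_nonneg P f c _) (localCost_nonneg f c _ 𝒞))
    (one_le_pow₀ (by norm_num))

theorem excess_merge_lt_or_numPure_merge_lt_of_isContested (h : IsIntervalPartition P 𝒞)
    (hf : MonotoneOn f P) (hg : IsGreedyMerge 𝒞 A B) (hi : IsContested f (merge 𝒞 A B) i)
    (hnear : (A ∪ B).image f ⊆ near i) :
    excess f (near i) (merge 𝒞 A B) < excess f (near i) 𝒞 ∨
      numPure f (near i) (merge 𝒞 A B) < numPure f (near i) 𝒞 := by
  obtain ⟨hA, hB, hAB, -⟩ := id hg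
  have hpure : ∃ j, A ∈ clustersWithin f {j} 𝒞 ∨ B ∈ clustersWithin f {j} 𝒞 := by
    by_contra! hmixed
    exact not_isContested_merge h hf hg (fun j => (hmixed j).1) (fun j => (hmixed j).2) hnear hi
  obtain ⟨j, hj⟩ := hpure
  have hcolor : ∀ Q ∈ clustersWithin f {j} 𝒞, Q ⊆ A ∪ B → j ∈ near i := fun Q hQ hsub => by
    obtain ⟨hQ𝒞, hQj⟩ := mem_clustersWithin_singleton.1 hQ
    obtain ⟨x, hx⟩ := h.nonempty Q hQ𝒞
    exact hQj x hx ▸ hnear (Finset.mem_image_of_mem f (hsub hx))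
  exact excess_merge_lt_or_numPure_merge_lt hA hB hAB
    (hj.elim (fun hj => hcolor A hj Finset.subset_union_left)
      fun hj => hcolor B hj Finset.subset_union_right) hj

theorem localBudget_merge_le (h : IsIntervalPartition P 𝒞) (hf : MonotoneOn f P)
    (hg : IsGreedyMerge 𝒞 A B) (c : ℕ → ℝ) (hi : IsContested f (merge 𝒞 A B) i) :
    localBudget P f c i (merge 𝒞 A B) ≤ localBudget P f c i 𝒞 := by
  have hnonneg : ∀ 𝒟, 0 ≤ colorCost P f c (near i) + localCost f c (near i) 𝒟 := fun 𝒟 =>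
    add_nonneg (colorCost_nonneg P f c _) (localCost_nonneg f c _ 𝒟)
  have := hnonneg 𝒞
  have := hnonneg (merge 𝒞 A B)
  rw [localBudget, localBudget]
  by_cases hpure : numPure f (near i) (merge 𝒞 A B) < numPure f (near i) 𝒞
  · have hlocal := localCost_merge_le h hg f c (near i)
    have hmerge := mergeCost_le_of_isContested h hg c (hi.of_merge h hg)
    calc 5 ^ numPure f (near i) (merge 𝒞 A B) *
          (colorCost P f c (near i) + localCost f c (near i) (merge 𝒞 A B))
        ≤ 5 ^ numPure f (near i) (merge 𝒞 A B) *
          (5 * (colorCost P f c (near i) + localCost f c (near i) 𝒞)) := by gcongr; linarith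
      _ = 5 ^ (numPure f (near i) (merge 𝒞 A B) + 1) *
          (colorCost P f c (near i) + localCost f c (near i) 𝒞) := by ring
      _ ≤ 5 ^ numPure f (near i) 𝒞 *
          (colorCost P f c (near i) + localCost f c (near i) 𝒞) := by
        gcongr
        · norm_num
        · exact hpure
  · have hlocal := localCost_merge_le_self h hg c fun hnear =>
      (excess_merge_lt_or_numPure_merge_lt_of_isContested h hf hg hi hnear).resolve_right hpure
    have hle := numPure_merge_le hg.1 hg.2.1 hg.2.2.1 f (near i)
    gcongr
    norm_num

theorem card_near_le (i : ℕ) : (near i).card ≤ 3 := by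
  rw [near, Nat.card_Icc]
  omega

theorem localBudget_image_singleton_le (P : Finset ℝ) (f : ℝ → ℕ) (c : ℕ → ℝ) (i : ℕ) :
    localBudget P f c i (P.image fun x => {x}) ≤ 375 * colorCost P f c (near i) := by
  have hlocal := localCost_image_singleton_le P f c (near i)
  have hcolor := colorCost_nonneg P f c (near i)
  have hpure : numPure f (near i) (P.image fun x => {x}) ≤ 3 :=
    (Finset.card_filter_le _ _).trans (card_near_le i)
  calc localBudget P f c i (P.image fun x => {x})
      ≤ 5 ^ 3 * (colorCost P f c (near i) + 2 * colorCost P f c (near i)) := by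
        rw [localBudget]
        gcongr
        · exact add_nonneg hcolor (localCost_nonneg f c _ _)
        · norm_num
    _ = 375 * colorCost P f c (near i) := by ring

end LocalBudget

section Runs

variable {P : Finset ℝ} {W : ℕ → Finset (Finset ℝ)} {f : ℝ → ℕ} {i κ t : ℕ}

/-- The increase of the total cost in step `t + 1`, which is the cost of the merge performed. -/
noncomputable def stepCost (W : ℕ → Finset (Finset ℝ)) (t : ℕ) : ℝ :=
  ∑ Q ∈ W (t + 1), cost Q - ∑ Q ∈ W t, cost Q

theorem sum_sum_near_le {g : ℕ → ℝ} (hg : ∀ i, 0 ≤ g i) (hgκ : ∀ i, κ ≤ i → g i = 0) :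
    ∑ i ∈ Finset.range κ, ∑ j ∈ near i, g j ≤ 3 * ∑ j ∈ Finset.range κ, g j := by
  have hsupport : ∀ i, ∑ j ∈ near i, g j = ∑ j ∈ near i with j < κ, g j := fun i =>
    (Finset.sum_filter_of_ne fun j _ hj => not_le.1 (mt (hgκ j) hj)).symm
  rw [Finset.sum_congr rfl fun i _ => hsupport i,
    Finset.sum_comm' (t' := Finset.range κ) (s' := fun j => {i ∈ near j | i < κ}), Finset.mul_sum]
  · refine Finset.sum_le_sum fun j _ => ?_
    rw [Finset.sum_const, nsmul_eq_mul]
    refine mul_le_mul_of_nonneg_right ?_ (hg j)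
    exact mod_cast (Finset.card_filter_le _ _).trans (card_near_le j)
  · intro i j
    simp only [near, Finset.mem_filter, Finset.mem_range, Finset.mem_Icc]
    omega

theorem sum_colorCost_near_le (hrange : P.image f = Finset.range κ) (c : ℕ → ℝ) :
    ∑ i ∈ Finset.range κ, colorCost P f c (near i) ≤ 3 * colorCost P f c (Finset.range κ) := by
  refine sum_sum_near_le (fun j => costAt_nonneg _ _) fun i hi => Finset.sum_eq_zero fun x hx => ?_
  obtain ⟨hxP, hxi⟩ := Finset.mem_filter.1 hx
  have hlt := Finset.mem_range.1 (hrange ▸ Finset.mem_image_of_mem f hxP)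
  omega

namespace IsWardClustering

theorem isIntervalPartition (hW : IsWardClustering P W) (ht : t < P.card) :
    IsIntervalPartition P (W t) := by
  induction t with
  | zero => exact hW.init ▸ IsIntervalPartition.singletons P
  | succ t ih =>
    obtain ⟨A, B, hg, heq⟩ := hW.step t ht
    exact heq ▸ hg.isIntervalPartition_merge (ih (by omega))

theorem card_add (hW : IsWardClustering P W) (ht : t < P.card) : (W t).card + t = P.card := by
  induction t with
  | zero => rw [hW.init, Finset.card_image_of_injective _ Finset.singleton_injective, add_zero]
  | succ t ih =>
    obtain ⟨A, B, ⟨hA, hB, hAB, -⟩, heq⟩ := hW.step t ht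
    have hcard := card_merge hA hB hAB ((hW.isIntervalPartition (by omega)).union_notMem_sdiff hA B)
    rw [← ih (by omega), heq, ← hcard]
    omega

theorem exists_greedyMerge (hW : IsWardClustering P W) (ht : t + 1 < P.card) :
    ∃ A B, IsGreedyMerge (W t) A B ∧ W (t + 1) = merge (W t) A B ∧
      stepCost W t = mergeCost A B := by
  obtain ⟨A, B, hg, heq⟩ := hW.step t ht
  refine ⟨A, B, hg, heq, ?_⟩
  rw [stepCost, heq, sum_cost_merge hg.1 hg.2.1 hg.2.2.1
    ((hW.isIntervalPartition (by omega)).union_notMem_sdiff hg.1 B), add_sub_cancel_left]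

theorem stepCost_nonneg (hW : IsWardClustering P W) (ht : t + 1 < P.card) : 0 ≤ stepCost W t := by
  obtain ⟨A, B, hg, -, hcost⟩ := hW.exists_greedyMerge ht
  exact hcost ▸ mergeCost_nonneg (hg.disjoint (hW.isIntervalPartition (by omega)))

theorem stepCost_le_stepCost_succ (hW : IsWardClustering P W) (ht : t + 2 < P.card) :
    stepCost W t ≤ stepCost W (t + 1) := by
  obtain ⟨A, B, hg, heq, hcost⟩ := hW.exists_greedyMerge (t := t) (by omega)
  obtain ⟨A', B', ⟨hA', hB', hne, -⟩, -, hcost'⟩ := hW.exists_greedyMerge ht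
  rw [heq] at hA' hB'
  rw [hcost, hcost']
  exact hg.le_of_merge (hW.isIntervalPartition (by omega)) hA' hB' hne

theorem sum_stepCost (hW : IsWardClustering P W) (J : ℕ) :
    ∑ t ∈ Finset.range J, stepCost W t = ∑ Q ∈ W J, cost Q := by
  have hinit : ∑ Q ∈ W 0, cost Q = 0 := by
    rw [hW.init, Finset.sum_image Finset.singleton_injective.injOn]
    exact Finset.sum_eq_zero fun x _ => cost_singleton x
  simp only [stepCost]
  rw [Finset.sum_range_sub (fun t => ∑ Q ∈ W t, cost Q), hinit, sub_zero]

theorem localBudget_le (hW : IsWardClustering P W) (hf : MonotoneOn f P) (c : ℕ → ℝ)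
    (ht : t < P.card) (hi : IsContested f (W t) i) :
    localBudget P f c i (W t) ≤ 375 * colorCost P f c (near i) := by
  induction t with
  | zero => exact hW.init ▸ localBudget_image_singleton_le P f c i
  | succ t ih =>
    obtain ⟨A, B, hg, heq⟩ := hW.step t ht
    have h := hW.isIntervalPartition (t := t) (by omega)
    rw [heq] at hi ⊢
    exact (localBudget_merge_le h hf hg c hi).trans (ih (by omega) (hi.of_merge h hg))

theorem stepCost_le_of_isContested (hW : IsWardClustering P W) (hf : MonotoneOn f P) (c : ℕ → ℝ)
    (ht : t + 1 < P.card) (hi : IsContested f (W t) i) :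
    stepCost W t ≤ 1500 * colorCost P f c (near i) := by
  obtain ⟨A, B, hg, -, hcost⟩ := hW.exists_greedyMerge ht
  have h := hW.isIntervalPartition (t := t) (by omega)
  linarith [mergeCost_le_localBudget h hg c hi, hW.localBudget_le hf c (by omega) hi]

theorem excess_add_mul_stepCost_le (hW : IsWardClustering P W) (hf : MonotoneOn f P) (c : ℕ → ℝ)
    (ht : t + 1 < P.card) (κ : ℕ) :
    (excess f (Finset.range κ) (W t) + 2 * (contestedColors f κ (W t)).card) * stepCost W t ≤
      2 * potential f c (Finset.range κ) (W t) +
        2 * ∑ i ∈ contestedColors f κ (W t), 1500 * colorCost P f c (near i) := by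
  obtain ⟨A, B, hg, -, hcost⟩ := hW.exists_greedyMerge ht
  have hexcess := excess_mul_mergeCost_le (hW.isIntervalPartition (by omega)) hg f c
    (Finset.range κ)
  have hcontested := card_sub_card_mul_le_sum_sub (Finset.empty_subset (contestedColors f κ (W t)))
    fun i hi => hW.stepCost_le_of_isContested hf c ht (mem_contestedColors.1 hi).2
  rw [Finset.card_empty, Nat.cast_zero, sub_zero, Finset.sum_empty, sub_zero] at hcontested
  rw [← hcost] at hexcess
  linarith

theorem excess_add_sub_mul_stepCost_le (hW : IsWardClustering P W) (hf : MonotoneOn f P)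
    (c : ℕ → ℝ) (ht : t + 1 < P.card) (κ : ℕ) :
    ((excess f (Finset.range κ) (W t) + 2 * (contestedColors f κ (W t)).card : ℝ) -
        (excess f (Finset.range κ) (W (t + 1)) +
          2 * (contestedColors f κ (W (t + 1))).card)) * stepCost W t ≤
      2 * potential f c (Finset.range κ) (W t) +
          2 * ∑ i ∈ contestedColors f κ (W t), 1500 * colorCost P f c (near i) -
        (2 * potential f c (Finset.range κ) (W (t + 1)) +
          2 * ∑ i ∈ contestedColors f κ (W (t + 1)), 1500 * colorCost P f c (near i)) := by
  obtain ⟨A, B, hg, heq, hcost⟩ := hW.exists_greedyMerge ht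
  have h := hW.isIntervalPartition (t := t) (by omega)
  have hexcess := excess_sub_mul_mergeCost_le h hg f c (Finset.range κ)
  have hcontested := card_sub_card_mul_le_sum_sub (contestedColors_merge_subset h hg f κ)
    fun i hi => hW.stepCost_le_of_isContested hf c ht (mem_contestedColors.1 hi).2
  rw [← heq] at hexcess hcontested
  rw [← hcost] at hexcess
  linarith

theorem sub_le_excess_add (hW : IsWardClustering P W) (hf : MonotoneOn f P)
    (hrange : P.image f = Finset.range κ) (ht : t < P.card) :
    (P.card : ℝ) - κ - t ≤
      excess f (Finset.range κ) (W t) + 2 * (contestedColors f κ (W t)).card := by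
  have hcard : (P.card : ℝ) ≤
      excess f (Finset.range κ) (W t) + κ + 2 * (contestedColors f κ (W t)).card + t := by
    rw [← hW.card_add ht]
    exact mod_cast Nat.add_le_add_right
      (card_le_excess_add (hW.isIntervalPartition ht) hf hrange) t
  linarith

theorem sum_cost_le (hW : IsWardClustering P W) (hf : MonotoneOn f P)
    (hrange : P.image f = Finset.range κ) (c : ℕ → ℝ) {J : ℕ} (hJ : J < P.card)
    (hJκ : J + κ ≤ P.card) :
    ∑ Q ∈ W J, cost Q ≤ 9002 * colorCost P f c (Finset.range κ) := by
  rw [← hW.sum_stepCost]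
  have hcolor := colorCost_nonneg P f c (Finset.range κ)
  rcases J.eq_zero_or_pos with rfl | hpos
  · rw [Finset.sum_range_zero]
    positivity
  have hspent := sum_range_le_of_reserve
    (n := fun t => excess f (Finset.range κ) (W t) + 2 * (contestedColors f κ (W t)).card)
    (a := fun t => 2 * potential f c (Finset.range κ) (W t) +
      2 * ∑ i ∈ contestedColors f κ (W t), 1500 * colorCost P f c (near i))
    (hW.stepCost_nonneg (by omega))
    (fun t ht => hW.stepCost_le_stepCost_succ (by omega))
    (fun t ht => by
      have hJκ' : (J : ℝ) + κ ≤ P.card := mod_cast hJκ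
      linarith [hW.sub_le_excess_add hf hrange (t := t) (by omega)])
    (fun t ht => hW.excess_add_mul_stepCost_le hf c (by omega) κ)
    (fun t ht => hW.excess_add_sub_mul_stepCost_le hf c (by omega) κ) hpos
  have hpotential : potential f c (Finset.range κ) (W 0) ≤ colorCost P f c (Finset.range κ) :=
    hW.init ▸ potential_image_singleton_le P f c _
  have hcontested : ∑ i ∈ contestedColors f κ (W 0), 1500 * colorCost P f c (near i) ≤
      1500 * ∑ i ∈ Finset.range κ, colorCost P f c (near i) := by
    rw [Finset.mul_sum]
    exact Finset.sum_le_sum_of_subset_of_nonneg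
      (fun i hi => Finset.mem_range.2 (mem_contestedColors.1 hi).1)
      fun i _ _ => mul_nonneg (by norm_num) (colorCost_nonneg P f c _)
  linarith [sum_colorCost_near_le hrange c]

end IsWardClustering

end Runs

section Optimum

theorem exists_monotone_nearest {C : Finset ℝ} (hC : C.Nonempty) :
    ∃ g : ℝ → ℝ, Monotone g ∧ ∀ x, g x ∈ C ∧ ∀ d ∈ C, (x - g x) ^ 2 ≤ (x - d) ^ 2 := by
  choose g hgC hgmin using fun x => C.exists_min_image (fun d => (x - d) ^ 2) hC
  refine ⟨g, monotone_iff_forall_lt.2 fun x y hxy => ?_, fun x => ⟨hgC x, hgmin x⟩⟩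
  by_contra! hlt
  have hx := hgmin x (g y) (hgC y)
  have hy := hgmin y (g x) (hgC x)
  have hcross := mul_pos (sub_pos.2 hxy) (sub_pos.2 hlt)
  linarith

theorem strictMonoOn_card_filter_lt {β : Type*} [LinearOrder β] (S : Finset β) :
    StrictMonoOn (fun y => {z ∈ S | z < y}.card) S := fun y hy _ _ hlt =>
  Finset.card_lt_card <| Finset.ssubset_iff_of_subset
    (Finset.monotone_filter_right S fun _ _ hz => hz.trans hlt) |>.2
    ⟨y, Finset.mem_filter.2 ⟨hy, hlt⟩, fun hmem => lt_irrefl y (Finset.mem_filter.1 hmem).2⟩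

theorem image_card_filter_lt {β : Type*} [LinearOrder β] (S : Finset β) :
    S.image (fun y => {z ∈ S | z < y}.card) = Finset.range S.card := by
  refine Finset.eq_of_subset_of_card_le (Finset.image_subset_iff.2 fun y hy => ?_) ?_
  · exact Finset.mem_range.2 (Finset.card_lt_card (Finset.filter_ssubset.2 ⟨y, hy, lt_irrefl y⟩))
  · rw [Finset.card_range, Finset.card_image_of_injOn (strictMonoOn_card_filter_lt S).injOn]

theorem exists_coloring_factor {α β : Type*} [Preorder α] [LinearOrder β] [Nonempty β]
    (P : Finset α) {g : α → β} (hg : MonotoneOn g P) :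
    ∃ (f : α → ℕ) (c : ℕ → β), MonotoneOn f P ∧
      P.image f = Finset.range (P.image g).card ∧ ∀ x ∈ P, c (f x) = g x := by
  have hrank := strictMonoOn_card_filter_lt (P.image g)
  have hmem : ∀ x ∈ P, g x ∈ P.image g := fun x hx => Finset.mem_image_of_mem g hx
  refine ⟨fun x => {z ∈ P.image g | z < g x}.card, Function.invFunOn _ (P.image g : Set β),
    hrank.monotoneOn.comp hg hmem, ?_, fun x hx => hrank.injOn.leftInvOn_invFunOn (hmem x hx)⟩
  rw [← image_card_filter_lt, Finset.image_image]
  rfl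

theorem colorCost_range_eq {P : Finset ℝ} {f : ℝ → ℕ} {κ : ℕ}
    (hrange : P.image f = Finset.range κ) (c : ℕ → ℝ) :
    colorCost P f c (Finset.range κ) = ∑ x ∈ P, (x - c (f x)) ^ 2 := by
  rw [← Finset.sum_fiberwise_of_maps_to fun x hx => hrange ▸ Finset.mem_image_of_mem f hx]
  exact Finset.sum_congr rfl fun i _ => Finset.sum_congr rfl fun x hx => by
    rw [(Finset.mem_filter.1 hx).2]

theorem exists_coloring_colorCost_le (P : Finset ℝ) {C : Finset ℝ} (hC : C.Nonempty) :
    ∃ κ ≤ C.card, ∃ (f : ℝ → ℕ) (c : ℕ → ℝ), MonotoneOn f P ∧ P.image f = Finset.range κ ∧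
      colorCost P f c (Finset.range κ) ≤ kMeansCost P C := by
  obtain ⟨g, hmono, hg⟩ := exists_monotone_nearest hC
  obtain ⟨f, c, hf, hrange, hc⟩ := exists_coloring_factor P (hmono.monotoneOn _)
  refine ⟨_, Finset.card_le_card (Finset.image_subset_iff.2 fun x _ => (hg x).1), f, c, hf,
    hrange, ?_⟩
  have := hC.to_subtype
  rw [colorCost_range_eq hrange]
  refine Finset.sum_le_sum fun x hx => ?_
  rw [hc x hx]
  exact le_ciInf fun d => (hg x).2 d d.2

end Optimum

end Ward

theorem mainTheorem3 :
    ∃ α : ℝ, ∀ (P : Finset ℝ) (k : ℕ), 1 ≤ k → k ≤ P.card →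
      ∀ W : ℕ → Finset (Finset ℝ), Ward.IsWardClustering P W →
        Ward.hierarchicalCost P W k ≤ α * Ward.opt k P := by
  refine ⟨9002, fun P k hk hkP W hW => ?_⟩
  rw [← div_le_iff₀' (by norm_num)]
  refine le_csInf ?_ ?_
  · obtain ⟨C, -, hC⟩ := Finset.exists_subset_card_eq hkP
    exact ⟨_, C, hC, rfl⟩
  · rintro _ ⟨C, rfl, rfl⟩
    obtain ⟨κ, hκ, f, c, hf, hrange, hle⟩ :=
      Ward.exists_coloring_colorCost_le P (Finset.card_pos.1 hk)
    rw [div_le_iff₀' (by norm_num), Ward.hierarchicalCost]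
    calc ∑ Q ∈ W (P.card - C.card), Ward.cost Q
        ≤ 9002 * Ward.colorCost P f c (Finset.range κ) :=
          hW.sum_cost_le hf hrange c (by omega) (by omega)
      _ ≤ 9002 * Ward.kMeansCost P C := by gcongr
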